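/- An odd continued fraction with leading term $0$ is a finite or infinite expression $$\left[0;\frac{\varepsilon_1}{a_1},\frac{\varepsilon_2}{a_2},\ldots\right]=\cfrac{\varepsilon_1}{a_1+\cfrac{\varepsilon_2}{a_2+\cdots}}$$ (an infinite one being understood as the limit of its convergents), in which all $a_j$ are odd positive integers, $\varepsilon_j=\pm1$, $\varepsilon_1=1$, $a_j+\varepsilon_{j+1}\ge 2$ for all $j\ge1$, and, if the expression is finite with last pair $\varepsilon_l/a_l$ and $a_l=1$, then $\varepsilon_l=1$. The empty expression represents $0$. For $n\ge 0$ let $\mathcal Y_n$ be the set of those $x\in\mathbb Q\cap[0,1]$ that have a finite representation of this form with sum of partial quotients $a_1+\dots+a_l\le n+1$. Then each $\mathcal Y_n$ is finite and nonempty, and with $$F^0_n(x)=\frac{\#\{\xi\in\mathcal Y_n:\ \xi\le x\}}{\#\mathcal Y_n}$$ the limit $F^0(x)=\lim_{n\to\infty}F^0_n(x)$ exists for every $x\in[0,1]$. The equation $\lambda^3-\lambda^2-\lambda-1=0$ has exactly one real root $\lambda$, and if $x\in[0,1]$ is represented as $x=[0;\varepsilon_1/a_1,\varepsilon_2/a_2,\ldots]$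 in the above form, then $$F^0(x)=-\sum_{i\ge1}\frac{E_i}{\lambda^{A_i}},\qquad E_i=\prod_{j=1}^{i}(-\varepsilon_j),\qquad A_i=\sum_{j=1}^{i}a_j-1,$$ where the sum runs over the indices $i$ that occur in the representation and, if it is infinite, converges. For rational $x\in[0,1]$ the sum is finite: $x$ has a finite representation and no infinite one. -/

import Mathlib

namespace OddCF

open Filter Topology

/-- A finite string of pairs `(ε_j, a_j)`: the data of `[0; ε_1/a_1, …, ε_l/a_l]`.
The empty string stands for `0`. -/
abbrev Digits := List (ℤ × ℕ)

/-- The value `ε_1/(a_1 + ε_2/(a_2 + ⋯ + ε_l/a_l))`. -/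
def value : Digits → ℚ
  | [] => 0
  | d :: t => (d.1 : ℚ) / ((d.2 : ℚ) + value t)

/-- The sum of partial quotients `a_1 + ⋯ + a_l`. -/
def digitSum (c : Digits) : ℕ := (c.map Prod.snd).sum

/-- The product `(-ε_1) ⋯ (-ε_l)`. -/
def signProd (c : Digits) : ℤ := (c.map fun d => -d.1).prod

/-- Finite odd continued fractions with leading term `0`. -/
structure IsFinite (c : Digits) : Prop where
  odd : ∀ d ∈ c, Odd d.2
  sign : ∀ d ∈ c, d.1 = 1 ∨ d.1 = -1
  head : ∀ d ∈ c.head?, d.1 = 1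
  chain : c.IsChain fun d e => 2 ≤ (d.2 : ℤ) + e.1
  last : ∀ d ∈ c.getLast?, d.2 = 1 → d.1 = 1

/-- Infinite odd continued fractions with leading term `0`;
`c j` is the pair `(ε_{j+1}, a_{j+1})`. -/
structure IsInfinite (c : ℕ → ℤ × ℕ) : Prop where
  odd : ∀ j, Odd (c j).2
  sign : ∀ j, (c j).1 = 1 ∨ (c j).1 = -1
  head : (c 0).1 = 1
  chain : ∀ j, 2 ≤ ((c j).2 : ℤ) + (c (j + 1)).1

/-- The first `k` pairs of an infinite string. -/
def initial (c : ℕ → ℤ × ℕ) (k : ℕ) : Digits := (List.range k).map c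

/-- `x` is represented by the finite odd continued fraction `c`. -/
def FiniteRep (x : ℝ) (c : Digits) : Prop :=
  IsFinite c ∧ (value c : ℝ) = x

/-- `x` is represented by the infinite odd continued fraction `c`:
it is the limit of the convergents. -/
def InfiniteRep (x : ℝ) (c : ℕ → ℤ × ℕ) : Prop :=
  IsInfinite c ∧ Tendsto (fun k => (value (initial c k) : ℝ)) atTop (𝓝 x)

/-- The rationals of `[0,1]` whose sum of partial quotients is at most `n + 1`. -/
def Y (n : ℕ) : Set ℝ :=
  {x | x ∈ Set.range ((↑) : ℚ → ℝ) ∩ Set.Icc 0 1 ∧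
    ∃ c : Digits, FiniteRep x c ∧ digitSum c ≤ n + 1}

/-- The distribution function of a finite set `M`: the proportion of elements `ξ ≤ x`. -/
noncomputable def distribution (M : Set ℝ) (x : ℝ) : ℝ :=
  ({ξ ∈ M | ξ ≤ x}.ncard : ℝ) / (M.ncard : ℝ)

/-- `F` is the limit distribution function on `[0,1]` of the sequence `M` of
(nonempty) finite subsets of `[0,1]`. -/
def IsLimitDistribution (M : ℕ → Set ℝ) (F : ℝ → ℝ) : Prop :=
  (∀ n, (M n).Finite ∧ (M n).Nonempty ∧ M n ⊆ Set.Icc 0 1) ∧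
    ∀ x ∈ Set.Icc (0 : ℝ) 1, Tendsto (fun n => distribution (M n) x) atTop (𝓝 (F x))

/-- For `c = ((ε_1, a_1), …, (ε_i, a_i))` this is `E_i / λ ^ A_i`, where
`E_i = ∏_{j ≤ i} (-ε_j)` and `A_i = ∑_{j ≤ i} a_j - 1`. -/
noncomputable def term (lam : ℝ) (c : Digits) : ℝ :=
  (signProd c : ℝ) / lam ^ ((digitSum c : ℤ) - 1)

end OddCF

namespace OddCF

open Filter Topology

/-! Looking at the first partial quotient splits the positive values with digit sum at most n into
three monotone branches with disjoint ranges (`mem_Pos_cases`): a_1 = 1 gives 1/(1+t) in [1/2,1],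
order reversing, at level n-1; lowering a_1 by 2, where legal, gives 1/(2+1/y) in (0,1/3], at level
n-2; a_1 = 3 followed by a minus sign gives 1/(3-s) in (1/3,1/2), at level n-3. Hence the
cardinalities are tribonacci from n = 4 on and are asymptotic to C * lam^n with C > 0
(`total_asymptotic`).

The same splitting, with the counting function N_n extended oddly, gives N_n(ε/(a+τ)) =
ε(total(n-a+1) - N_{n-a}(τ)) up to an error of at most 1 (`signedCount_step`). After division by
lam^n, a limit f must satisfy f(ε/(a+τ)) = ε(C lam^(1-a) - lam^(-a) f(τ)). Unrolling this along the
digits yields -C times the asserted series, and F^0 = f/C.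

For finite expansions the unrolling is an induction. For infinite ones each step shrinks the unknown
remainder by lam^(-a) ≤ 5/9, which allows the limits in n and in the number of digits to be
interchanged. Infinite expansions enter through their sequences of tails (`IsOrbit`); a rational
number starts no such sequence, since denominators would descend forever. -/

/-! ### Finite tails and the range of their values -/

/-- Strings that may occur as tails of a finite odd continued fraction: the first sign is free. -/
def IsTail : Digits → Prop
  | [] => True
  | d :: t => Odd d.2 ∧ (d.1 = 1 ∨ d.1 = -1) ∧ (t = [] → d.2 = 1 → d.1 = 1) ∧
      (∀ e ∈ t.head?, 2 ≤ (d.2 : ℤ) + e.1) ∧ IsTail t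

/-- The recursive form is closed under dropping the first pair, which the sign condition on the head
is not; this makes induction possible. -/
theorem isFinite_iff (c : Digits) :
    IsFinite c ↔ IsTail c ∧ ∀ d ∈ c.head?, d.1 = 1 := by
  have key : ∀ c : Digits, IsTail c ↔ (∀ d ∈ c, Odd d.2) ∧ (∀ d ∈ c, d.1 = 1 ∨ d.1 = -1) ∧
      (c.IsChain fun d e => 2 ≤ (d.2 : ℤ) + e.1) ∧ (∀ d ∈ c.getLast?, d.2 = 1 → d.1 = 1) := by
    intro c
    induction c with
    | nil => simp [IsTail]
    | cons d t ih =>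
      rw [IsTail, ih]
      cases t with
      | nil => simp
      | cons e u =>
        simp only [List.isChain_cons_cons, List.getLast?_cons_cons, List.forall_mem_cons]
        simp
        tauto
  constructor
  · rintro ⟨h1, h2, h3, h4, h5⟩
    exact ⟨(key c).2 ⟨h1, h2, h4, h5⟩, h3⟩
  · rintro ⟨h, h3⟩
    obtain ⟨h1, h2, h4, h5⟩ := (key c).1 h
    exact ⟨h1, h2, h3, h4, h5⟩

theorem isTail_cons (d : ℤ × ℕ) (t : Digits) :
    IsTail (d :: t) ↔ Odd d.2 ∧ (d.1 = 1 ∨ d.1 = -1) ∧ (t = [] → d.2 = 1 → d.1 = 1) ∧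
      (∀ e ∈ t.head?, 2 ≤ (d.2 : ℤ) + e.1) ∧ IsTail t := Iff.rfl

theorem value_cons (d : ℤ × ℕ) (t : Digits) :
    value (d :: t) = (d.1 : ℚ) / ((d.2 : ℚ) + value t) := rfl

theorem digitSum_cons (d : ℤ × ℕ) (t : Digits) : digitSum (d :: t) = d.2 + digitSum t := by
  simp [digitSum]

theorem three_le_of_odd {a : ℕ} (h : Odd a) (h1 : a ≠ 1) : 3 ≤ a := by
  obtain ⟨k, rfl⟩ := h
  omega

/-- The value of a tail lies in `(-1, 1]` and has the sign of the first digit. -/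
theorem IsTail.bounds : ∀ {c : Digits}, IsTail c →
    -1 < value c ∧ value c ≤ 1 ∧ (∀ d ∈ c.head?, 0 < d.1 * value c) := by
  intro c
  induction c with
  | nil => intro _; simp [value]
  | cons d t ih =>
    rintro ⟨ho, hs, hl, hc, ht⟩
    obtain ⟨h1, h2, h3⟩ := ih ht
    have hval : (d.2 = 1 → 0 ≤ value t ∧ (value t = 0 → t = [])) := by
      intro hd
      cases t with
      | nil => simp [value]
      | cons e u =>
        have he : e.1 = 1 := by
          have := hc e (by simp)
          rcases ht.2.1 with h | h <;> omega
        have := h3 e (by simp)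
        rw [he] at this
        norm_num at this
        exact ⟨this.le, fun h => absurd h this.ne'⟩
    -- The denominator is 1 only for a final quotient 1, where the last-pair condition forces the
    -- sign +; so the value -1 is never attained.
    have hge : (1 : ℚ) ≤ d.2 + value t ∧ ((d.2 : ℚ) + value t = 1 → d.1 = 1) := by
      by_cases hd : d.2 = 1
      · obtain ⟨h4, h5⟩ := hval hd
        rw [hd]
        push_cast
        refine ⟨by linarith, fun h => hl (h5 (by linarith)) hd⟩
      · have : (3 : ℚ) ≤ d.2 := by exact_mod_cast three_le_of_odd ho hd
        exact ⟨by linarith, fun h => by linarith⟩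
    rw [value_cons]
    have hpos : (0 : ℚ) < d.2 + value t := by linarith [hge.1]
    have hle : 1 / ((d.2 : ℚ) + value t) ≤ 1 := by
      rw [div_le_one hpos]; exact hge.1
    have hip : 0 < 1 / ((d.2 : ℚ) + value t) := by positivity
    rcases hs with h | h
    · rw [h]
      push_cast
      refine ⟨by linarith, hle, ?_⟩
      intro e he
      simp at he
      rw [← he, h]
      push_cast
      linarith
    · have hne : (d.2 : ℚ) + value t ≠ 1 := fun h' => by
        have := hge.2 h'; omega
      have hlt : 1 / ((d.2 : ℚ) + value t) < 1 := by
        rw [div_lt_one hpos]; exact lt_of_le_of_ne hge.1 (Ne.symm hne)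
      rw [h]
      push_cast
      rw [neg_div]
      refine ⟨by linarith, by linarith, ?_⟩
      intro e he
      simp at he
      rw [← he, h]
      push_cast
      linarith

theorem IsTail.nonneg_of_one {d : ℤ × ℕ} {t : Digits} (h : IsTail (d :: t)) (hd : d.2 = 1) :
    0 ≤ value t := by
  cases t with
  | nil => simp [value]
  | cons e u =>
    have he : e.1 = 1 := by
      have := h.2.2.2.1 e (by simp)
      rcases h.2.2.2.2.2.1 with h | h <;> omega
    have := h.2.2.2.2.bounds.2.2 e (by simp)
    rw [he] at this
    norm_num at this
    exact this.le

/-! ### Decomposition by the first partial quotient -/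

/-- The positive values of finite odd continued fractions with digit sum at most `n`. -/
def Pos (n : ℤ) : Set ℝ :=
  {x | ∃ (a : ℕ) (t : Digits), IsTail ((1, a) :: t) ∧ (value ((1, a) :: t) : ℝ) = x ∧
    (digitSum ((1, a) :: t) : ℤ) ≤ n}

theorem pos_of_mem_Pos {n : ℤ} {x : ℝ} (hx : x ∈ Pos n) : 0 < x := by
  obtain ⟨a, t, h, rfl, -⟩ := hx
  have := h.bounds.2.2 (1, a) (by simp)
  norm_num at this
  exact_mod_cast this

theorem le_one_of_mem_Pos {n : ℤ} {x : ℝ} (hx : x ∈ Pos n) : x ≤ 1 := by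
  obtain ⟨a, t, h, rfl, -⟩ := hx
  exact_mod_cast h.bounds.2.1

theorem one_le_of_mem_Pos {n : ℤ} {x : ℝ} (hx : x ∈ Pos n) : 1 ≤ n := by
  obtain ⟨a, t, h, rfl, hn⟩ := hx
  rw [digitSum_cons] at hn
  have := h.1.pos
  push_cast at hn
  simp at this
  omega

theorem mem_Y_iff (n : ℕ) (x : ℝ) : x ∈ Y n ↔ x = 0 ∨ x ∈ Pos (n + 1) := by
  constructor
  · rintro ⟨-, c, ⟨hf, hx⟩, hn⟩
    rw [isFinite_iff] at hf
    cases c with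
    | nil => left; rw [← hx]; simp [value]
    | cons d t =>
      right
      have hd : d = (1, d.2) := by
        have := hf.2 d (by simp)
        exact Prod.ext this rfl
      rw [hd] at hf hx hn
      exact ⟨d.2, t, hf.1, hx, by exact_mod_cast hn⟩
  · rintro (rfl | hx)
    · refine ⟨⟨⟨0, by simp⟩, by simp⟩, [], ⟨?_, by simp [value]⟩, by simp [digitSum]⟩
      rw [isFinite_iff]; simp [IsTail]
    · refine ⟨⟨?_, (pos_of_mem_Pos hx).le, le_one_of_mem_Pos hx⟩, ?_⟩
      · obtain ⟨a, t, h, rfl, hn⟩ := hx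
        exact ⟨_, rfl⟩
      · obtain ⟨a, t, h, rfl, hn⟩ := hx
        refine ⟨(1, a) :: t, ⟨?_, rfl⟩, by exact_mod_cast hn⟩
        rw [isFinite_iff]; simp [h]

/-- Lowering a first quotient a ≥ 3 by 2 breaks the chain condition only if a = 3 and the next sign
is -1; this is the last alternative. There s ≠ 1 because tails have values above -1. -/
theorem mem_Pos_iff (n : ℤ) (x : ℝ) : x ∈ Pos n ↔ (1 ≤ n ∧ x = 1) ∨
    (∃ t ∈ Pos (n - 1), x = 1 / (1 + t)) ∨ (∃ y ∈ Pos (n - 2), x = 1 / (2 + 1 / y)) ∨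
    (∃ s ∈ Pos (n - 3), s ≠ 1 ∧ x = 1 / (3 - s)) := by
  constructor
  · rintro ⟨a, t, h, rfl, hn⟩
    rw [digitSum_cons] at hn
    push_cast at hn
    simp only [isTail_cons] at h
    obtain ⟨ho, -, -, hc, ht⟩ := h
    by_cases ha : a = 1
    · subst ha
      cases t with
      | nil => left; simp [value, digitSum] at hn ⊢; omega
      | cons e u =>
        right; left
        have he : e = (1, e.2) := by
          have := hc e (by simp)
          refine Prod.ext ?_ rfl
          rcases ht.2.1 with h | h <;> simp at this ⊢ <;> omega
        rw [he] at ht hn ⊢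
        refine ⟨_, ⟨e.2, u, ht, rfl, by push_cast at hn; linarith⟩, ?_⟩
        rw [value_cons (1, 1)]; push_cast; simp
    · have ha3 := three_le_of_odd ho ha
      right; right
      obtain ⟨b, rfl⟩ : ∃ b, a = b + 2 := ⟨a - 2, by omega⟩
      have hob : Odd b := by
        rcases ho with ⟨k, hk⟩; exact ⟨k - 1, by omega⟩
      by_cases hneg : b = 1 ∧ ∃ e ∈ t.head?, e.1 = -1
      · right
        obtain ⟨rfl, e, he, he1⟩ := hneg
        obtain ⟨u, rfl⟩ : ∃ u, t = e :: u := by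
          cases t with
          | nil => simp at he
          | cons f u => simp at he; exact ⟨u, by rw [he]⟩
        have hts := ht
        simp only [isTail_cons] at ht
        have hv : value ((-1, e.2) :: u) = - value ((1, e.2) :: u) := by
          rw [value_cons, value_cons]; push_cast; ring
        have hee : e = (-1, e.2) := Prod.ext he1 rfl
        refine ⟨value ((1, e.2) :: u), ⟨e.2, u, ?_, rfl, ?_⟩, ?_, ?_⟩
        · simp only [isTail_cons]
          exact ⟨ht.1, by simp, by simp, ht.2.2.2.1, ht.2.2.2.2⟩
        · rw [digitSum_cons] at hn ⊢
          push_cast at hn ⊢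
          linarith
        · intro h1
          have := hts.bounds.1
          rw [hee, hv] at this
          have h1' : value ((1, e.2) :: u) = 1 := by exact_mod_cast h1
          rw [h1'] at this
          exact lt_irrefl _ this
        · rw [value_cons (1, 1 + 2), hee, hv]
          push_cast; norm_num [sub_eq_add_neg]
      · left
        have hb : IsTail ((1, b) :: t) := by
          simp only [isTail_cons]
          refine ⟨hob, by simp, by simp, ?_, ht⟩
          intro e he
          have hes : e.1 = 1 ∨ e.1 = -1 := by
            cases t with
            | nil => simp at he
            | cons f u => simp at he; rw [← he]; exact ht.2.1
          have := hob.pos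
          rcases hes with h | h
          · rw [h]; omega
          · by_cases hb1 : b = 1
            · exact absurd ⟨hb1, e, he, h⟩ hneg
            · have := three_le_of_odd hob hb1
              rw [h]; omega
        refine ⟨_, ⟨b, t, hb, rfl, ?_⟩, ?_⟩
        · rw [digitSum_cons]; push_cast at hn ⊢; linarith
        · rw [value_cons, value_cons]; push_cast
          rw [one_div_one_div]; ring
  · rintro (⟨hn, rfl⟩ | ⟨_, ⟨a, t, h, rfl, hn⟩, rfl⟩ | ⟨_, ⟨a, t, h, rfl, hn⟩, rfl⟩ |
      ⟨_, ⟨a, t, h, rfl, hn⟩, h1, rfl⟩)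
    · exact ⟨1, [], by simp [IsTail], by simp [value], by simpa [digitSum] using hn⟩
    · refine ⟨1, (1, a) :: t, ?_, ?_, ?_⟩
      · rw [isTail_cons]
        refine ⟨odd_one, by simp, by simp, by simp, h⟩
      · rw [value_cons (1, 1)]; push_cast; norm_num
      · rw [digitSum_cons]; push_cast; linarith
    · have h' := h
      simp only [isTail_cons] at h
      refine ⟨a + 2, t, ?_, ?_, ?_⟩
      · simp only [isTail_cons]
        refine ⟨h.1.add_even even_two, by simp, by simp, ?_, h.2.2.2.2⟩
        intro e he
        have := h.2.2.2.1 e he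
        push_cast; linarith
      · rw [value_cons, value_cons]; push_cast
        rw [one_div_one_div]; ring
      · rw [digitSum_cons] at hn ⊢; push_cast at hn ⊢; linarith
    · have h' := h
      simp only [isTail_cons] at h
      refine ⟨3, (-1, a) :: t, ?_, ?_, ?_⟩
      · simp only [isTail_cons]
        refine ⟨by decide, by simp, by simp, by simp, h.1, by simp, ?_, h.2.2.2⟩
        rintro rfl rfl
        simp [value] at h1
      · rw [value_cons (1, 3), value_cons (-1, a), value_cons (1, a)]; push_cast
        ring
      · rw [digitSum_cons] at hn ⊢; rw [digitSum_cons]; push_cast at hn ⊢; linarith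

/-- Integer levels keep the shifts by 1, 2, 3 free of truncated subtraction. -/
theorem Pos_eq_empty {n : ℤ} (hn : n ≤ 0) : Pos n = ∅ := by
  ext x
  simp only [Set.mem_empty_iff_false, iff_false]
  intro h
  have := one_le_of_mem_Pos h
  omega

/-! ### The three branches and their order -/

/-- The branch with values in `(0, 1/3]`. -/
noncomputable def shiftTwo (y : ℝ) : ℝ := 1 / (2 + 1 / y)

/-- The branch with values in `(1/3, 1/2)`. -/
noncomputable def threeSub (s : ℝ) : ℝ := 1 / (3 - s)

/-- The branch with values in `[1/2, 1]`. -/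
noncomputable def oneAdd (t : ℝ) : ℝ := 1 / (1 + t)

theorem shiftTwo_le_iff {y z : ℝ} (hy : 0 < y) (hz : 0 < z) :
    shiftTwo y ≤ shiftTwo z ↔ y ≤ z := by
  have := one_div_pos.2 hy
  have := one_div_pos.2 hz
  rw [shiftTwo, shiftTwo, one_div_le_one_div (by positivity) (by positivity),
    add_le_add_iff_left, one_div_le_one_div hz hy]

theorem threeSub_le_iff {y z : ℝ} (hy : y ≤ 1) (hz : z ≤ 1) :
    threeSub y ≤ threeSub z ↔ y ≤ z := by
  rw [threeSub, threeSub, one_div_le_one_div (by linarith) (by linarith)]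
  constructor <;> intro h <;> linarith

theorem oneAdd_le_iff {y z : ℝ} (hy : 0 ≤ y) (hz : 0 ≤ z) :
    oneAdd y ≤ oneAdd z ↔ z ≤ y := by
  rw [oneAdd, oneAdd, one_div_le_one_div (by linarith) (by linarith)]
  constructor <;> intro h <;> linarith

theorem shiftTwo_le {y : ℝ} (hy : 0 < y) (h1 : y ≤ 1) : shiftTwo y ≤ 1 / 3 := by
  have : shiftTwo 1 = 1 / 3 := by norm_num [shiftTwo]
  rw [← this, shiftTwo_le_iff hy one_pos]
  exact h1

theorem lt_threeSub {s : ℝ} (hs : 0 < s) (h1 : s ≤ 1) : 1 / 3 < threeSub s := by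
  have : threeSub 0 = 1 / 3 := by norm_num [threeSub]
  rw [← this, lt_iff_not_ge, threeSub_le_iff h1 zero_le_one]
  exact not_le.2 hs

theorem le_threeSub {s : ℝ} (hs : 0 ≤ s) (h1 : s ≤ 1) : 1 / 3 ≤ threeSub s := by
  have : threeSub 0 = 1 / 3 := by norm_num [threeSub]
  rw [← this, threeSub_le_iff zero_le_one h1]
  exact hs

theorem threeSub_lt {s : ℝ} (h1 : s < 1) : threeSub s < 1 / 2 := by
  have : threeSub 1 = 1 / 2 := by norm_num [threeSub]
  rw [← this, lt_iff_not_ge, threeSub_le_iff le_rfl h1.le]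
  exact not_le.2 h1

theorem le_oneAdd {t : ℝ} (h0 : 0 ≤ t) (h1 : t ≤ 1) : 1 / 2 ≤ oneAdd t := by
  have : oneAdd 1 = 1 / 2 := by norm_num [oneAdd]
  rw [← this, oneAdd_le_iff zero_le_one h0]
  exact h1

theorem mem_Pos_cases {n : ℤ} {x : ℝ} (hx : x ∈ Pos n) :
    (∃ t ∈ insert 0 (Pos (n - 1)), x = oneAdd t) ∨ (∃ y ∈ Pos (n - 2), x = shiftTwo y) ∨
    (∃ s ∈ Pos (n - 3), s < 1 ∧ x = threeSub s) := by
  rcases (mem_Pos_iff n x).1 hx with ⟨-, rfl⟩ | ⟨t, ht, rfl⟩ | ⟨y, hy, rfl⟩ | ⟨s, hs, h1, rfl⟩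
  · exact Or.inl ⟨0, by simp, by simp [oneAdd]⟩
  · exact Or.inl ⟨t, by simp [ht], rfl⟩
  · exact Or.inr (Or.inl ⟨y, hy, rfl⟩)
  · exact Or.inr (Or.inr ⟨s, hs, lt_of_le_of_ne (le_one_of_mem_Pos hs) h1, rfl⟩)

theorem oneAdd_mem {n : ℤ} (hn : 1 ≤ n) {t : ℝ} (ht : t ∈ insert 0 (Pos (n - 1))) :
    oneAdd t ∈ Pos n := by
  rw [mem_Pos_iff]
  rcases ht with rfl | ht
  · exact Or.inl ⟨hn, by simp [oneAdd]⟩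
  · exact Or.inr (Or.inl ⟨t, ht, rfl⟩)

theorem shiftTwo_mem {n : ℤ} {y : ℝ} (hy : y ∈ Pos (n - 2)) : shiftTwo y ∈ Pos n := by
  rw [mem_Pos_iff]
  exact Or.inr (Or.inr (Or.inl ⟨y, hy, rfl⟩))

theorem threeSub_mem {n : ℤ} {s : ℝ} (hs : s ∈ Pos (n - 3)) (h1 : s < 1) :
    threeSub s ∈ Pos n := by
  rw [mem_Pos_iff]
  exact Or.inr (Or.inr (Or.inr ⟨s, hs, h1.ne, rfl⟩))

theorem bounds_of_mem_insert {n : ℤ} {t : ℝ} (ht : t ∈ insert 0 (Pos n)) : 0 ≤ t ∧ t ≤ 1 := by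
  rcases ht with rfl | ht
  · simp
  · exact ⟨(pos_of_mem_Pos ht).le, le_one_of_mem_Pos ht⟩

theorem finite_Pos (n : ℤ) : (Pos n).Finite := by
  have key : ∀ k : ℕ, ∀ n : ℤ, n ≤ k → (Pos n).Finite := by
    intro k
    induction k with
    | zero => intro n hn; rw [Pos_eq_empty (by simpa using hn)]; exact Set.finite_empty
    | succ k ih =>
      intro n hn
      push_cast at hn
      refine (((((ih (n - 1) (by omega)).insert 0).image oneAdd).union
        ((ih (n - 2) (by omega)).image shiftTwo)).union
        ((ih (n - 3) (by omega)).image threeSub)).subset ?_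
      intro x hx
      rcases mem_Pos_cases hx with ⟨t, ht, rfl⟩ | ⟨y, hy, rfl⟩ | ⟨s, hs, -, rfl⟩
      · exact Or.inl (Or.inl ⟨t, ht, rfl⟩)
      · exact Or.inl (Or.inr ⟨y, hy, rfl⟩)
      · exact Or.inr ⟨s, hs, rfl⟩
  exact key n.toNat n (Int.self_le_toNat n)

/-! ### Counting recursions -/

/-- The number of elements of `Pos n` that are at most `x`. -/
noncomputable def count (n : ℤ) (x : ℝ) : ℝ := ((Pos n ∩ Set.Iic x).ncard : ℝ)

/-- The number of elements of `Pos n`. -/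
noncomputable def total (n : ℤ) : ℝ := ((Pos n).ncard : ℝ)

theorem count_nonneg (n : ℤ) (x : ℝ) : 0 ≤ count n x := Nat.cast_nonneg _

theorem count_le_total (n : ℤ) (x : ℝ) : count n x ≤ total n :=
  Nat.cast_le.2 (Set.ncard_le_ncard Set.inter_subset_left (finite_Pos n))

theorem count_zero (n : ℤ) : count n 0 = 0 := by
  rw [count]
  have : Pos n ∩ Set.Iic 0 = ∅ := by
    ext x
    simp only [Set.mem_inter_iff, Set.mem_Iic, Set.mem_empty_iff_false, iff_false]
    rintro ⟨h1, h2⟩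
    exact absurd (pos_of_mem_Pos h1) (not_lt.2 h2)
  rw [this]; simp

theorem total_eq_zero {n : ℤ} (hn : n ≤ 0) : total n = 0 := by
  rw [total, Pos_eq_empty hn]; simp

theorem count_eq_zero {n : ℤ} (hn : n ≤ 0) (x : ℝ) : count n x = 0 := by
  rw [count, Pos_eq_empty hn]; simp

theorem injOn_shiftTwo (n : ℤ) : Set.InjOn shiftTwo (Pos n) := by
  intro y hy z hz h
  exact le_antisymm ((shiftTwo_le_iff (pos_of_mem_Pos hy) (pos_of_mem_Pos hz)).1 h.le)
    ((shiftTwo_le_iff (pos_of_mem_Pos hz) (pos_of_mem_Pos hy)).1 h.ge)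

theorem injOn_threeSub (n : ℤ) : Set.InjOn threeSub (Pos n) := by
  intro y hy z hz h
  exact le_antisymm ((threeSub_le_iff (le_one_of_mem_Pos hy) (le_one_of_mem_Pos hz)).1 h.le)
    ((threeSub_le_iff (le_one_of_mem_Pos hz) (le_one_of_mem_Pos hy)).1 h.ge)

theorem injOn_oneAdd (n : ℤ) : Set.InjOn oneAdd (insert 0 (Pos n)) := by
  intro y hy z hz h
  have hy := (bounds_of_mem_insert hy).1
  have hz := (bounds_of_mem_insert hz).1
  exact le_antisymm ((oneAdd_le_iff hz hy).1 h.ge) ((oneAdd_le_iff hy hz).1 h.le)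

theorem count_shiftTwo (n : ℤ) {y : ℝ} (h0 : 0 < y) (h1 : y ≤ 1) :
    count n (shiftTwo y) = count (n - 2) y := by
  have : Pos n ∩ Set.Iic (shiftTwo y) = shiftTwo '' (Pos (n - 2) ∩ Set.Iic y) := by
    ext x
    have hy3 := shiftTwo_le h0 h1
    constructor
    · rintro ⟨hx, hxy⟩
      rw [Set.mem_Iic] at hxy
      rcases mem_Pos_cases hx with ⟨t, ht, rfl⟩ | ⟨z, hz, rfl⟩ | ⟨s, hs, -, rfl⟩
      · have := le_oneAdd (bounds_of_mem_insert ht).1 (bounds_of_mem_insert ht).2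
        linarith
      · exact ⟨z, ⟨hz, (shiftTwo_le_iff (pos_of_mem_Pos hz) h0).1 hxy⟩, rfl⟩
      · have := lt_threeSub (pos_of_mem_Pos hs) (le_one_of_mem_Pos hs)
        linarith
    · rintro ⟨z, ⟨hz, hzy⟩, rfl⟩
      exact ⟨shiftTwo_mem hz, (shiftTwo_le_iff (pos_of_mem_Pos hz) h0).2 hzy⟩
  rw [count, count, this, ((injOn_shiftTwo _).mono Set.inter_subset_left).ncard_image]

theorem disjoint_branches (n m : ℤ) :
    Disjoint (shiftTwo '' Pos n) (threeSub '' Pos m) := by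
  rw [Set.disjoint_left]
  rintro _ ⟨y, hy, rfl⟩ ⟨s, hs, h⟩
  have := shiftTwo_le (pos_of_mem_Pos hy) (le_one_of_mem_Pos hy)
  have := lt_threeSub (pos_of_mem_Pos hs) (le_one_of_mem_Pos hs)
  linarith

theorem count_threeSub (n : ℤ) {s : ℝ} (h0 : 0 ≤ s) (h1 : s < 1) :
    count n (threeSub s) = total (n - 2) + count (n - 3) s := by
  have : Pos n ∩ Set.Iic (threeSub s) =
      shiftTwo '' Pos (n - 2) ∪ threeSub '' (Pos (n - 3) ∩ Set.Iic s) := by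
    ext x
    have hs2 := threeSub_lt h1
    have hs3 := le_threeSub h0 h1.le
    constructor
    · rintro ⟨hx, hxy⟩
      rw [Set.mem_Iic] at hxy
      rcases mem_Pos_cases hx with ⟨t, ht, rfl⟩ | ⟨z, hz, rfl⟩ | ⟨z, hz, -, rfl⟩
      · have := le_oneAdd (bounds_of_mem_insert ht).1 (bounds_of_mem_insert ht).2
        linarith
      · exact Or.inl ⟨z, hz, rfl⟩
      · exact Or.inr ⟨z, ⟨hz, (threeSub_le_iff (le_one_of_mem_Pos hz) h1.le).1 hxy⟩, rfl⟩
    · rintro (⟨z, hz, rfl⟩ | ⟨z, ⟨hz, hzs⟩, rfl⟩)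
      · exact ⟨shiftTwo_mem hz, (shiftTwo_le (pos_of_mem_Pos hz) (le_one_of_mem_Pos hz)).trans hs3⟩
      · exact ⟨threeSub_mem hz (lt_of_le_of_lt hzs h1),
          (threeSub_le_iff (le_one_of_mem_Pos hz) h1.le).2 hzs⟩
  rw [count, count, total, this, Set.ncard_union_eq
    ((disjoint_branches _ _).mono_right (Set.image_mono Set.inter_subset_left))
    ((finite_Pos _).image _) (((finite_Pos _).inter_of_left _).image _), (injOn_shiftTwo _).ncard_image,
    ((injOn_threeSub _).mono Set.inter_subset_left).ncard_image]
  push_cast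
  rfl

/-- The elements above `oneAdd t`. -/
theorem Pos_inter_Ioi (n : ℤ) (hn : 1 ≤ n) {t : ℝ} (h0 : 0 ≤ t) (h1 : t ≤ 1) :
    Pos n ∩ Set.Ioi (oneAdd t) = oneAdd '' (insert 0 (Pos (n - 1)) ∩ Set.Iio t) := by
  ext x
  have ht2 := le_oneAdd h0 h1
  constructor
  · rintro ⟨hx, hxt⟩
    rw [Set.mem_Ioi] at hxt
    rcases mem_Pos_cases hx with ⟨z, hz, rfl⟩ | ⟨z, hz, rfl⟩ | ⟨z, hz, hz1, rfl⟩
    · refine ⟨z, ⟨hz, ?_⟩, rfl⟩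
      rw [lt_iff_not_ge, oneAdd_le_iff (bounds_of_mem_insert hz).1 h0] at hxt
      exact not_le.1 hxt
    · have := shiftTwo_le (pos_of_mem_Pos hz) (le_one_of_mem_Pos hz)
      linarith
    · have := threeSub_lt hz1
      linarith
  · rintro ⟨z, ⟨hz, hzt⟩, rfl⟩
    refine ⟨oneAdd_mem hn hz, ?_⟩
    rw [Set.mem_Ioi, lt_iff_not_ge, oneAdd_le_iff (bounds_of_mem_insert hz).1 h0]
    exact not_le.2 hzt

/-- Elements above `oneAdd t` correspond to parameters below t. The error 1 arises since order
reversal turns `≤ t` into `< t` and the parameter 0 is added. -/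
theorem count_oneAdd (n : ℤ) {t : ℝ} (h0 : 0 ≤ t) (h1 : t ≤ 1) :
    |count n (oneAdd t) - (total n - count (n - 1) t)| ≤ 1 := by
  by_cases hn : n ≤ 0
  · rw [count_eq_zero hn, total_eq_zero hn, count_eq_zero (by omega)]
    simp
  push Not at hn
  have hsplit : (Pos n ∩ Set.Iic (oneAdd t)).ncard + (Pos n ∩ Set.Ioi (oneAdd t)).ncard
      = (Pos n).ncard := by
    rw [← Set.ncard_union_eq _ ((finite_Pos _).inter_of_left _) ((finite_Pos _).inter_of_left _),
      ← Set.inter_union_distrib_left, Set.Iic_union_Ioi, Set.inter_univ]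
    exact (Set.Iic_disjoint_Ioi le_rfl).mono Set.inter_subset_right
      Set.inter_subset_right
  rw [Pos_inter_Ioi n hn h0 h1, ((injOn_oneAdd _).mono Set.inter_subset_left).ncard_image] at hsplit
  have hle : (insert 0 (Pos (n - 1)) ∩ Set.Iio t).ncard ≤
      (Pos (n - 1) ∩ Set.Iic t).ncard + 1 := by
    refine (Set.ncard_le_ncard (t := insert 0 (Pos (n - 1) ∩ Set.Iic t)) ?_
      (((finite_Pos _).inter_of_left _).insert _)).trans (Set.ncard_insert_le _ _)
    rintro x ⟨rfl | hx, hxt⟩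
    · exact Or.inl rfl
    · exact Or.inr ⟨hx, Set.mem_Iic.2 (le_of_lt hxt)⟩
  have hge : (Pos (n - 1) ∩ Set.Iic t).ncard ≤
      (insert 0 (Pos (n - 1)) ∩ Set.Iio t).ncard + 1 := by
    refine (Set.ncard_le_ncard (t := insert t (insert 0 (Pos (n - 1)) ∩ Set.Iio t)) ?_
      ((((finite_Pos _).insert _).inter_of_left _).insert _)).trans (Set.ncard_insert_le _ _)
    rintro x ⟨hx, hxt⟩
    rcases eq_or_lt_of_le (Set.mem_Iic.1 hxt) with h | h
    · exact Or.inl h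
    · exact Or.inr ⟨Or.inr hx, h⟩
  rw [count, count, total, ← hsplit, abs_le]
  have hle' : ((insert 0 (Pos (n - 1)) ∩ Set.Iio t).ncard : ℝ) ≤
      (Pos (n - 1) ∩ Set.Iic t).ncard + 1 := by exact_mod_cast hle
  have hge' : ((Pos (n - 1) ∩ Set.Iic t).ncard : ℝ) ≤
      (insert 0 (Pos (n - 1)) ∩ Set.Iio t).ncard + 1 := by exact_mod_cast hge
  push_cast
  constructor <;> linarith

theorem one_mem_Pos {n : ℤ} (hn : 1 ≤ n) : (1 : ℝ) ∈ Pos n :=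
  (mem_Pos_iff n 1).2 (Or.inl ⟨hn, rfl⟩)

/-- The summand 1 is the point `oneAdd 0 = 1`. The parameter s = 1 is removed because `threeSub 1 =
1/2` already lies in the first branch. -/
theorem total_rec {n : ℤ} (hn : 1 ≤ n) :
    total n = 1 + total (n - 1) + total (n - 2) + ((Pos (n - 3) \ {1}).ncard : ℝ) := by
  have hset : Pos n = oneAdd '' (insert 0 (Pos (n - 1))) ∪
      (shiftTwo '' Pos (n - 2) ∪ threeSub '' (Pos (n - 3) \ {1})) := by
    ext x
    constructor
    · intro hx
      rcases mem_Pos_cases hx with ⟨t, ht, rfl⟩ | ⟨z, hz, rfl⟩ | ⟨z, hz, hz1, rfl⟩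
      · exact Or.inl ⟨t, ht, rfl⟩
      · exact Or.inr (Or.inl ⟨z, hz, rfl⟩)
      · exact Or.inr (Or.inr ⟨z, ⟨hz, hz1.ne⟩, rfl⟩)
    · rintro (⟨t, ht, rfl⟩ | ⟨z, hz, rfl⟩ | ⟨z, hz, rfl⟩)
      · exact oneAdd_mem hn ht
      · exact shiftTwo_mem hz
      · exact threeSub_mem hz.1 (lt_of_le_of_ne (le_one_of_mem_Pos hz.1) hz.2)
  have h0 : (0 : ℝ) ∉ Pos (n - 1) := fun h => lt_irrefl _ (pos_of_mem_Pos h)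
  have hdisj : Disjoint (oneAdd '' (insert 0 (Pos (n - 1))))
      (shiftTwo '' Pos (n - 2) ∪ threeSub '' (Pos (n - 3) \ {1})) := by
    rw [Set.disjoint_left]
    rintro _ ⟨t, ht, rfl⟩ (⟨z, hz, h⟩ | ⟨z, hz, h⟩)
    · have := le_oneAdd (bounds_of_mem_insert ht).1 (bounds_of_mem_insert ht).2
      have := shiftTwo_le (pos_of_mem_Pos hz) (le_one_of_mem_Pos hz)
      linarith
    · have := le_oneAdd (bounds_of_mem_insert ht).1 (bounds_of_mem_insert ht).2
      have := threeSub_lt (lt_of_le_of_ne (le_one_of_mem_Pos hz.1) hz.2)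
      linarith
  have hf2 := (finite_Pos (n - 2)).image shiftTwo
  have hf3 := ((finite_Pos (n - 3)).subset (Set.sdiff_subset (t := {1}))).image threeSub
  rw [total, hset, Set.ncard_union_eq hdisj (((finite_Pos _).insert _).image _) (hf2.union hf3),
    Set.ncard_union_eq ((disjoint_branches _ _).mono_right (Set.image_mono Set.sdiff_subset))
    hf2 hf3, (injOn_oneAdd _).ncard_image, Set.ncard_insert_of_notMem h0 (finite_Pos _),
    (injOn_shiftTwo _).ncard_image,
    ((injOn_threeSub _).mono Set.sdiff_subset).ncard_image, total, total]
  push_cast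
  ring

/-- For n ≥ 4 the removed point 1 does belong to `Pos (n - 3)`, so its loss cancels the extra
summand 1. -/
theorem total_tribonacci {n : ℤ} (hn : 4 ≤ n) :
    total n = total (n - 1) + total (n - 2) + total (n - 3) := by
  have h := Set.ncard_sdiff_singleton_add_one (one_mem_Pos (n := n - 3) (by omega)) (finite_Pos _)
  have h' : ((Pos (n - 3) \ {1}).ncard : ℝ) + 1 = total (n - 3) := by
    rw [total]; exact_mod_cast h
  rw [total_rec (by omega)]
  linarith

theorem total_small {n : ℤ} (h1 : 1 ≤ n) (h3 : n ≤ 3) :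
    total n = 1 + total (n - 1) + total (n - 2) := by
  rw [total_rec h1, Pos_eq_empty (show n - 3 ≤ 0 by omega)]
  simp

theorem total_one : total 1 = 1 := by
  rw [total_small le_rfl (by norm_num), total_eq_zero (by norm_num), total_eq_zero (by norm_num)]
  norm_num

/-! ### The counting step for an arbitrary digit -/

/-- The odd extension of `count n`. -/
noncomputable def signedCount (n : ℤ) (v : ℝ) : ℝ := if 0 ≤ v then count n v else -count n (-v)

theorem signedCount_of_nonneg (n : ℤ) {v : ℝ} (hv : 0 ≤ v) : signedCount n v = count n v :=
  if_pos hv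

theorem signedCount_neg (n : ℤ) (v : ℝ) : signedCount n (-v) = -signedCount n v := by
  rcases lt_trichotomy v 0 with h | rfl | h
  · rw [signedCount, signedCount, if_pos (by linarith), if_neg (by linarith), neg_neg]
  · simp [signedCount, count_zero]
  · rw [signedCount, signedCount, if_neg (by linarith), if_pos h.le, neg_neg]

theorem abs_signedCount_le (n : ℤ) (v : ℝ) : |signedCount n v| ≤ total n := by
  rw [signedCount]
  split_ifs
  · rw [abs_of_nonneg (count_nonneg _ _)]; exact count_le_total _ _
  · rw [abs_neg, abs_of_nonneg (count_nonneg _ _)]; exact count_le_total _ _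

/-- Induction on a in steps of 2: `shiftTwo` transports counts exactly, so the error 1 of the base
case a = 1 does not accumulate. The case a = 3, τ < 0 cannot descend and is a second base case,
given exactly by `count_threeSub`. -/
theorem count_step {a : ℕ} (ha : Odd a) {τ : ℝ} (h1 : -1 < τ) (h2 : τ ≤ 1)
    (h0 : a = 1 → 0 ≤ τ) (n : ℤ) :
    |count n (1 / (a + τ)) - (total (n - a + 1) - signedCount (n - a) τ)| ≤ 1 := by
  obtain ⟨k, rfl⟩ := ha
  induction k generalizing n with
  | zero =>
    have hτ := h0 (by norm_num)
    have := count_oneAdd n hτ h2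
    rw [signedCount_of_nonneg _ hτ]
    simpa [oneAdd] using this
  | succ k ih =>
    by_cases hk : k = 0 ∧ τ < 0
    · obtain ⟨rfl, hτ⟩ := hk
      have h := count_threeSub n (s := -τ) (by linarith) (by linarith)
      have e : threeSub (-τ) = 1 / (((2 * (0 + 1) + 1 : ℕ) : ℝ) + τ) := by
        rw [threeSub]; push_cast; norm_num
      have e2 : signedCount (n - 3) τ = -count (n - 3) (-τ) := by
        rw [signedCount, if_neg (by linarith)]
      have e3 : n - ((2 * (0 + 1) + 1 : ℕ) : ℤ) = n - 3 := by norm_num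
      rw [← e, h, e3, e2, show n - 3 + 1 = n - 2 by ring]
      simp
    · have hk0 : 2 * k + 1 = 1 → 0 ≤ τ := by
        intro h
        by_contra hτ
        exact hk ⟨by omega, not_le.1 hτ⟩
      have hge : (1 : ℝ) ≤ ((2 * k + 1 : ℕ) : ℝ) + τ := by
        rcases Nat.eq_zero_or_pos k with rfl | hkp
        · have := hk0 (by norm_num)
          push_cast; linarith
        · have : (1 : ℝ) ≤ k := by exact_mod_cast hkp
          push_cast; linarith
      have h := ih (n - 2) hk0
      rw [← count_shiftTwo n (by positivity)
        ((div_le_one (by linarith)).2 hge)] at h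
      have e : shiftTwo (1 / (((2 * k + 1 : ℕ) : ℝ) + τ)) =
          1 / (((2 * (k + 1) + 1 : ℕ) : ℝ) + τ) := by
        rw [shiftTwo, one_div_one_div]; push_cast; ring_nf
      have e3 : n - ((2 * (k + 1) + 1 : ℕ) : ℤ) = n - 2 - ((2 * k + 1 : ℕ) : ℤ) := by
        push_cast; ring
      rw [e3, ← e]
      exact h

theorem signedCount_step {ε : ℤ} (hε : ε = 1 ∨ ε = -1) {a : ℕ} (ha : Odd a) {τ : ℝ}
    (h1 : -1 < τ) (h2 : τ ≤ 1) (h0 : a = 1 → 0 ≤ τ) (n : ℤ) :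
    |signedCount n (ε / (a + τ)) - ε * (total (n - a + 1) - signedCount (n - a) τ)| ≤ 1 := by
  have hge : (0 : ℝ) ≤ (a : ℝ) + τ := by
    have : (1 : ℝ) ≤ a := by exact_mod_cast ha.pos
    linarith
  have h := count_step ha h1 h2 h0 n
  rw [← signedCount_of_nonneg _ (by positivity)] at h
  rcases hε with rfl | rfl
  · simpa using h
  · rw [Int.cast_neg, Int.cast_one, neg_div, signedCount_neg, neg_one_mul, ← neg_sub', abs_neg]
    exact h

/-! ### The tribonacci root and growth of the totals -/

/-- The tribonacci polynomial has exactly one real root. -/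
theorem exists_tribonacci_root : ∃ lam : ℝ, 9 / 5 < lam ∧ lam < 19 / 10 ∧
    lam ^ 3 = lam ^ 2 + lam + 1 ∧ ∀ t : ℝ, t ^ 3 - t ^ 2 - t - 1 = 0 ↔ t = lam := by
  have hc : ContinuousOn (fun t : ℝ => t ^ 3 - t ^ 2 - t - 1) (Set.Icc (9 / 5) (19 / 10)) := by
    fun_prop
  obtain ⟨lam, ⟨h1, h2⟩, h⟩ := intermediate_value_Ioo (by norm_num) hc
    (show (0 : ℝ) ∈ Set.Ioo _ _ by norm_num)
  simp only at h
  refine ⟨lam, h1, h2, by linarith, fun t => ⟨fun ht => ?_, fun ht => by rw [ht]; exact h⟩⟩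
  -- The quadratic cofactor has negative discriminant for lam > 9/5, hence no real zero.
  have hf : (t - lam) * (t ^ 2 + (lam - 1) * t + (lam ^ 2 - lam - 1)) = 0 := by
    linear_combination ht - h
  rcases mul_eq_zero.1 hf with h' | h'
  · linarith
  · nlinarith [sq_nonneg (2 * t + (lam - 1))]

/-- A tribonacci sequence divided by the powers of the root converges. -/
theorem tribonacci_tendsto {lam : ℝ} (h1 : 9 / 5 < lam) (h2 : lam < 19 / 10)
    (hl : lam ^ 3 = lam ^ 2 + lam + 1) {u : ℕ → ℝ} (hu : ∀ n, u (n + 3) = u (n + 2) + u (n + 1) + u n)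
    (hpos : ∀ n, 0 ≤ u n) (h0 : 0 < u 0) :
    ∃ C : ℝ, 0 < C ∧ Tendsto (fun n => u n / lam ^ n) atTop (𝓝 C) := by
  have hlam : 0 < lam := by linarith
  obtain ⟨m, hm⟩ : ∃ m, m = lam ^ 2 - lam - 1 := ⟨_, rfl⟩
  have hlm : lam * m = 1 := by rw [hm]; linear_combination hl
  have hm1 : 1 / 2 < m := by nlinarith
  have hm2 : m < 1 := by nlinarith
  -- Subtracting lam * u n removes the dominant root: e obeys the recursion of the quadratic
  -- cofactor, whose complex roots have product m = 1/lam < 1.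
  obtain ⟨e, he⟩ : ∃ e : ℕ → ℝ, ∀ n, e n = u (n + 1) - lam * u n := ⟨_, fun _ => rfl⟩
  have hrec : ∀ n, e (n + 2) = -(lam - 1) * e (n + 1) - m * e n := by
    intro n
    rw [he, he, he, hu]
    linear_combination u (n + 1) * hm - u n * hlm
  -- A positive definite form that the recursion multiplies exactly by m; it bounds e without using
  -- complex roots.
  obtain ⟨V, hV⟩ : ∃ V : ℕ → ℝ,
      ∀ n, V n = e (n + 1) ^ 2 + (lam - 1) * e (n + 1) * e n + m * e n ^ 2 := ⟨_, fun _ => rfl⟩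
  have hVpos : ∀ n, 1 / 4 * e n ^ 2 ≤ V n := by
    intro n
    rw [hV]
    have hk : 0 ≤ (m - (lam - 1) ^ 2 / 4 - 1 / 4) * e n ^ 2 :=
      mul_nonneg (by nlinarith) (sq_nonneg _)
    nlinarith [sq_nonneg (e (n + 1) + (lam - 1) / 2 * e n)]
  have hVrec : ∀ n, V (n + 1) = m * V n := by
    intro n
    rw [hV, hV, hrec]
    ring
  have hVle : ∀ n, V n ≤ V 0 := by
    intro n
    induction n with
    | zero => exact le_rfl
    | succ n ih =>
      rw [hVrec]
      have : 0 ≤ V n := le_trans (by positivity) (hVpos n)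
      nlinarith
  have hbound : ∀ n, |e n| ≤ 1 + 4 * V 0 := by
    intro n
    have h3 := hVpos n
    have h4 := hVle n
    rw [abs_le]
    constructor <;> nlinarith [sq_nonneg (e n - 1), sq_nonneg (e n + 1)]
  have hcauchy : CauchySeq (fun n => u n / lam ^ n) := by
    refine cauchySeq_of_le_geometric m (1 + 4 * V 0) hm2 fun n => ?_
    have hmpow : m ^ n = 1 / lam ^ n := by
      rw [eq_div_iff (by positivity), ← mul_pow, mul_comm, hlm, one_pow]
    have : u n / lam ^ n - u (n + 1) / lam ^ (n + 1) = -(m * e n) * m ^ n := by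
      rw [hmpow, he]
      have hm' : m = 1 / lam := by rw [eq_div_iff hlam.ne', mul_comm]; exact hlm
      rw [hm']
      field_simp
      ring
    rw [Real.dist_eq, this, abs_mul, abs_neg, abs_mul, abs_of_pos (by linarith : 0 < m),
      abs_of_nonneg (by positivity : 0 ≤ m ^ n)]
    refine mul_le_mul_of_nonneg_right ?_ (by positivity)
    nlinarith [hbound n, abs_nonneg (e n)]
  obtain ⟨C, hC⟩ := cauchySeq_tendsto_of_complete hcauchy
  refine ⟨C, ?_, hC⟩
  have hC0 : 0 ≤ C := ge_of_tendsto' hC fun n => div_nonneg (hpos n) (by positivity)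
  -- Applying the quadratic cofactor to u kills the complex roots, so W is exactly geometric with
  -- ratio lam. Its coefficients are positive, which forces C > 0.
  obtain ⟨W, hW⟩ : ∃ W : ℕ → ℝ, ∀ n, W n = u (n + 2) + (lam - 1) * u (n + 1) + m * u n :=
    ⟨_, fun _ => rfl⟩
  have hWn : ∀ n, W n = W 0 * lam ^ n := by
    intro n
    induction n with
    | zero => simp
    | succ n ih =>
      rw [pow_succ, ← mul_assoc, ← ih, hW, hW, hu]
      linear_combination (u (n + 1)) * hm - u n * hlm
  have hlim : Tendsto (fun n => lam ^ 2 * (u (n + 2) / lam ^ (n + 2)) +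
      (lam - 1) * lam * (u (n + 1) / lam ^ (n + 1)) + m * (u n / lam ^ n)) atTop
      (𝓝 (lam ^ 2 * C + (lam - 1) * lam * C + m * C)) := by
    have hC1 := (tendsto_add_atTop_iff_nat 1).2 hC
    have hC2 := (tendsto_add_atTop_iff_nat 2).2 hC
    exact ((hC2.const_mul _).add (hC1.const_mul _)).add (hC.const_mul _)
  have hconst : (fun n => lam ^ 2 * (u (n + 2) / lam ^ (n + 2)) +
      (lam - 1) * lam * (u (n + 1) / lam ^ (n + 1)) + m * (u n / lam ^ n)) = fun _ => W 0 := by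
    funext n
    have : W 0 = W n / lam ^ n := by
      rw [hWn n, mul_div_assoc, div_self (by positivity), mul_one]
    rw [this, hW, pow_add, pow_add]
    field_simp
  rw [hconst] at hlim
  have hW0 : 0 < W 0 := by
    rw [hW]
    have := hpos 1
    have := hpos 2
    have : 0 ≤ (lam - 1) * u 1 := mul_nonneg (by linarith) (hpos 1)
    have : 0 < m * u 0 := mul_pos (by linarith) h0
    simp only [zero_add]
    linarith [hpos 2]
  have heq := tendsto_nhds_unique hlim tendsto_const_nhds
  rcases hC0.eq_or_lt with h | h
  · rw [← h] at heq; simp at heq; linarith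
  · exact h

theorem total_asymptotic {lam : ℝ} (h1 : 9 / 5 < lam) (h2 : lam < 19 / 10)
    (hl : lam ^ 3 = lam ^ 2 + lam + 1) :
    ∃ C : ℝ, 0 < C ∧ Tendsto (fun n : ℤ => total n / lam ^ n) atTop (𝓝 C) := by
  have hlam : 0 < lam := by linarith
  -- Starting at index 1 suits both hypotheses: the recursion begins at n = 4, and `total 1 = 1` is
  -- positive.
  obtain ⟨C, hC, h⟩ := tribonacci_tendsto h1 h2 hl (u := fun n : ℕ => total (n + 1))
    (fun n => by
      rw [total_tribonacci (by push_cast; omega)]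
      push_cast
      congr 2 <;> ring_nf) (fun n => Nat.cast_nonneg _) (by simp [total_one])
  refine ⟨C / lam, by positivity, ?_⟩
  rw [← Nat.map_cast_int_atTop, tendsto_map'_iff, ← tendsto_add_atTop_iff_nat 1]
  refine (h.div_const lam).congr fun n => ?_
  simp only [Function.comp]
  rw [zpow_natCast, pow_succ]
  push_cast
  field_simp

theorem eventually_total_le {lam : ℝ} {C : ℝ} (h : Tendsto (fun n : ℤ => total n / lam ^ n) atTop (𝓝 C)) :
    ∃ K : ℝ, 0 < K ∧ ∀ᶠ n : ℤ in atTop, total n / lam ^ n ≤ K := by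
  refine ⟨|C| + 1, by positivity, ?_⟩
  exact (h.eventually (gt_mem_nhds (show C < |C| + 1 by linarith [le_abs_self C]))).mono
    fun n hn => hn.le

/-! ### Partial sums of the series -/

/-- The sum of the terms of all nonempty initial segments of `c`. -/
noncomputable def termSum (lam : ℝ) (c : Digits) : ℝ :=
  ∑ i ∈ Finset.Icc 1 c.length, term lam (c.take i)

theorem termSum_eq_range (lam : ℝ) (c : Digits) :
    termSum lam c = ∑ i ∈ Finset.range c.length, term lam (c.take (i + 1)) := by
  rw [termSum, Finset.sum_bij' (fun i _ => i - 1) (fun i _ => i + 1)]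
  all_goals simp only [Finset.mem_Icc, Finset.mem_range]
  all_goals intro i hi
  · omega
  · omega
  · omega
  · omega
  · rw [Nat.sub_add_cancel hi.1]

theorem term_cons {lam : ℝ} (hlam : 0 < lam) (d : ℤ × ℕ) (t : Digits) :
    term lam (d :: t) = -d.1 * lam ^ (-(d.2 : ℤ)) * term lam t := by
  rw [term, term, digitSum_cons, signProd, signProd, List.map_cons, List.prod_cons]
  push_cast
  rw [show (d.2 : ℤ) + digitSum t - 1 = d.2 + ((digitSum t : ℤ) - 1) by ring,
    zpow_add₀ hlam.ne', zpow_neg]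
  field_simp

theorem term_nil (lam : ℝ) : term lam [] = lam := by
  simp [term, signProd, digitSum]

/-- This is the recursion of the limit density, up to the factor -C. The part lam^(1-a) comes from
the empty string, whose term is lam. -/
theorem termSum_cons {lam : ℝ} (hlam : 0 < lam) (d : ℤ × ℕ) (t : Digits) :
    termSum lam (d :: t) =
      -d.1 * (lam ^ (1 - (d.2 : ℤ)) + lam ^ (-(d.2 : ℤ)) * termSum lam t) := by
  rw [termSum_eq_range, termSum_eq_range, List.length_cons, Finset.sum_range_succ']
  simp only [List.take_succ_cons, term_cons hlam, List.take_zero, term_nil, zero_add]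
  rw [← Finset.mul_sum, sub_eq_add_neg, zpow_add₀ hlam.ne', zpow_one]
  ring

theorem termSum_nil (lam : ℝ) : termSum lam [] = 0 := by
  simp [termSum]

/-! ### Limits of the normalized counts -/

/-- The signed count at level `n` normalized by `lam ^ n`. -/
noncomputable def density (lam : ℝ) (n : ℤ) (v : ℝ) : ℝ := signedCount n v / lam ^ n

theorem tendsto_sub_const_atTop (a : ℤ) : Tendsto (fun n : ℤ => n - a) atTop atTop :=
  tendsto_atTop_add_const_right _ (-a) tendsto_id

section

variable {lam C : ℝ}

/-- The bounded counting error vanishes after division by lam^n. The density of τ is kept at level n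
- a, so that its convergence need not be known; infinite expansions require this. -/
theorem tendsto_density_step (hlam : 1 < lam)
    (hC : Tendsto (fun n : ℤ => total n / lam ^ n) atTop (𝓝 C))
    {ε : ℤ} (hε : ε = 1 ∨ ε = -1) {a : ℕ} (ha : Odd a) {τ : ℝ}
    (h1 : -1 < τ) (h2 : τ ≤ 1) (h0 : a = 1 → 0 ≤ τ) :
    Tendsto (fun n : ℤ => density lam n (ε / (a + τ)) -
      ε * (C * lam ^ (1 - (a : ℤ)) - lam ^ (-(a : ℤ)) * density lam (n - a) τ)) atTop (𝓝 0) := by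
  have hl0 : 0 < lam := by linarith
  have hpow : Tendsto (fun n : ℤ => 1 / lam ^ n) atTop (𝓝 0) := by
    rw [← Nat.map_cast_int_atTop, tendsto_map'_iff]
    have := tendsto_pow_atTop_nhds_zero_of_lt_one (r := 1 / lam) (by positivity)
      (by rw [div_lt_one hl0]; exact hlam)
    refine this.congr fun n => ?_
    simp [Function.comp]
  have hmain : Tendsto (fun n : ℤ => density lam n (ε / (a + τ)) -
      ε * (lam ^ (1 - (a : ℤ)) * (total (n - a + 1) / lam ^ (n - a + 1)) -
        lam ^ (-(a : ℤ)) * density lam (n - a) τ)) atTop (𝓝 0) := by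
    refine squeeze_zero_norm (fun n => ?_) hpow
    have h := signedCount_step hε ha h1 h2 h0 n
    have e : density lam n (ε / (a + τ)) -
      ε * (lam ^ (1 - (a : ℤ)) * (total (n - a + 1) / lam ^ (n - a + 1)) -
        lam ^ (-(a : ℤ)) * density lam (n - a) τ) =
        (signedCount n (ε / (a + τ)) -
          ε * (total (n - a + 1) - signedCount (n - a) τ)) / lam ^ n := by
      rw [density, density]
      have e1 : lam ^ n = lam ^ (n - a + 1) * lam ^ ((a : ℤ) - 1) := by
        rw [← zpow_add₀ hl0.ne']; congr 1; ring
      have e2 : lam ^ n = lam ^ (n - a) * lam ^ (a : ℤ) := by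
        rw [← zpow_add₀ hl0.ne']; congr 1; ring
      have e3 : lam ^ (1 - (a : ℤ)) * (total (n - a + 1) / lam ^ (n - a + 1)) =
          total (n - a + 1) / lam ^ n := by
        rw [e1, show 1 - (a : ℤ) = -((a : ℤ) - 1) by ring, zpow_neg]
        field_simp
      have e4 : lam ^ (-(a : ℤ)) * (signedCount (n - a) τ / lam ^ (n - a)) =
          signedCount (n - a) τ / lam ^ n := by
        rw [e2, zpow_neg]
        field_simp
      rw [e3, e4]
      ring
    have hp : 0 < lam ^ n := by positivity
    rw [e, Real.norm_eq_abs, abs_div, abs_of_pos hp]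
    gcongr
  have hshift : Tendsto (fun n : ℤ => ε * (lam ^ (1 - (a : ℤ)) *
      (total (n - a + 1) / lam ^ (n - a + 1)) - C * lam ^ (1 - (a : ℤ)))) atTop (𝓝 0) := by
    have h := hC.comp (tendsto_sub_const_atTop ((a : ℤ) - 1))
    have h' := ((h.const_mul (lam ^ (1 - (a : ℤ)))).sub_const
      (C * lam ^ (1 - (a : ℤ)))).const_mul (ε : ℝ)
    rw [mul_comm _ C, sub_self, mul_zero] at h'
    refine h'.congr fun n => ?_
    simp only [Function.comp]
    rw [show n - ((a : ℤ) - 1) = n - a + 1 by ring, mul_comm C]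
  have := hmain.add hshift
  rw [add_zero] at this
  refine this.congr fun n => ?_
  ring

theorem tendsto_density_value (hlam : 1 < lam)
    (hC : Tendsto (fun n : ℤ => total n / lam ^ n) atTop (𝓝 C)) (c : Digits) (hc : IsTail c) :
    Tendsto (fun n : ℤ => density lam n (value c : ℝ)) atTop (𝓝 (-(C * termSum lam c))) := by
  have hl0 : 0 < lam := by linarith
  induction c with
  | nil =>
    rw [termSum_nil]
    simp [value, density, signedCount, count_zero]
  | cons d t ih =>
    have ht := hc.2.2.2.2
    have hb := ht.bounds
    have h := tendsto_density_step hlam hC hc.2.1 hc.1 (τ := (value t : ℝ))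
      (by exact_mod_cast hb.1) (by exact_mod_cast hb.2.1)
      (fun h => by exact_mod_cast hc.nonneg_of_one h)
    have h' := h.add ((((ih ht).comp (tendsto_sub_const_atTop d.2)).const_mul
      (lam ^ (-(d.2 : ℤ)))).const_sub (C * lam ^ (1 - (d.2 : ℤ))) |>.const_mul (d.1 : ℝ))
    rw [termSum_cons hl0, value_cons]
    push_cast
    convert h' using 2
    · simp only [Function.comp]; ring
    · ring

/-! ### Infinite expansions as orbits -/

/-- `x` is the sequence of complete tails of the infinite string `c`. -/
structure IsOrbit (c : ℕ → ℤ × ℕ) (x : ℕ → ℝ) : Prop where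
  odd : ∀ j, Odd (c j).2
  sign : ∀ j, (c j).1 = 1 ∨ (c j).1 = -1
  abs_lt : ∀ j, |x j| < 1
  eq : ∀ j, x j = (c j).1 / ((c j).2 + x (j + 1))

theorem IsOrbit.shift {c : ℕ → ℤ × ℕ} {x : ℕ → ℝ} (h : IsOrbit c x) :
    IsOrbit (fun j => c (j + 1)) (fun j => x (j + 1)) :=
  ⟨fun _ => h.odd _, fun _ => h.sign _, fun _ => h.abs_lt _, fun _ => h.eq _⟩

theorem IsOrbit.pos {c : ℕ → ℤ × ℕ} {x : ℕ → ℝ} (h : IsOrbit c x) (j : ℕ) :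
    0 < ((c j).2 : ℝ) + x (j + 1) := by
  have h1 : (1 : ℝ) ≤ (c j).2 := by exact_mod_cast (h.odd j).pos
  have := (_root_.abs_lt.1 (h.abs_lt (j + 1))).1
  linarith

/-- Since |x_j| is the reciprocal of this denominator, |x_j| < 1 gives the bound. In particular a
quotient 1 is followed by a positive tail, so orbits need no separate chain condition. -/
theorem IsOrbit.one_lt {c : ℕ → ℤ × ℕ} {x : ℕ → ℝ} (h : IsOrbit c x) (j : ℕ) :
    1 < ((c j).2 : ℝ) + x (j + 1) := by
  have hp := h.pos j
  have h2 := h.abs_lt j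
  rw [h.eq j, abs_div, abs_of_pos hp, div_lt_one hp] at h2
  rcases h.sign j with h3 | h3 <;> rw [h3] at h2 <;> simpa using h2

theorem initial_succ (c : ℕ → ℤ × ℕ) (k : ℕ) :
    initial c (k + 1) = c 0 :: initial (fun j => c (j + 1)) k := by
  rw [initial, initial, List.range_succ_eq_map, List.map_cons, List.map_map]
  rfl

/-- K is uniform in k and in the orbit; only the threshold for n depends on them. -/
theorem eventually_density_orbit (hlam : 9 / 5 < lam)
    (hC : Tendsto (fun n : ℤ => total n / lam ^ n) atTop (𝓝 C)) :
    ∃ K : ℝ, ∀ (k : ℕ) (c : ℕ → ℤ × ℕ) (x : ℕ → ℝ), IsOrbit c x →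
      ∀ᶠ n : ℤ in atTop,
        |density lam n (x 0) + C * termSum lam (initial c k)| ≤ K * (3 / 4) ^ k := by
  have hl0 : 0 < lam := by linarith
  obtain ⟨K, hK, hle⟩ := eventually_total_le hC
  refine ⟨K, fun k => ?_⟩
  induction k with
  | zero =>
    intro c x _
    refine hle.mono fun n hn => ?_
    have : initial c 0 = [] := rfl
    rw [this, termSum_nil, density, mul_zero, add_zero, abs_div, pow_zero, mul_one,
      abs_of_pos (by positivity : 0 < lam ^ n)]
    refine le_trans ?_ hn
    gcongr
    exact abs_signedCount_le _ _
  | succ k ih =>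
    intro c x h
    have hτ := abs_lt.1 (h.abs_lt 1)
    have h0 : (c 0).2 = 1 → 0 ≤ x 1 := by
      intro ha
      have := h.one_lt 0
      rw [ha] at this
      push_cast at this
      linarith
    have hs := tendsto_density_step (by linarith) hC (h.sign 0) (h.odd 0) hτ.1 hτ.2.le h0
    -- One digit contracts by 5/9; the slack up to 3/4 absorbs the vanishing error of the density
    -- step.
    have hη : 0 < K * (3 / 4) ^ k * (3 / 4 - 5 / 9) := by positivity
    have hs' := hs.eventually (Metric.ball_mem_nhds 0 hη)
    filter_upwards [hs', (tendsto_sub_const_atTop (c 0).2).eventually (ih _ _ h.shift)]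
      with n hn1 hn2
    rw [Real.dist_eq, sub_zero] at hn1
    rw [initial_succ, termSum_cons hl0, h.eq 0]
    simp only [zero_add] at hn2 ⊢
    have hlp : lam ^ (-((c 0).2 : ℤ)) ≤ 5 / 9 := by
      have h1 : lam ^ (-((c 0).2 : ℤ)) ≤ lam ^ (-1 : ℤ) := by
        refine zpow_le_zpow_right₀ (by linarith) ?_
        have := (h.odd 0).pos
        omega
      refine h1.trans ?_
      rw [zpow_neg_one, inv_le_comm₀ hl0 (by norm_num)]
      norm_num
      linarith
    have hlp0 : 0 < lam ^ (-((c 0).2 : ℤ)) := by positivity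
    have hsabs : |((c 0).1 : ℝ)| = 1 := by
      rcases h.sign 0 with h | h <;> rw [h] <;> simp
    set D := density lam (n - (c 0).2) (x 1)
    set T := termSum lam (initial (fun j => c (j + 1)) k)
    have e : density lam n ((c 0).1 / ((c 0).2 + x 1)) +
        C * (-(c 0).1 * (lam ^ (1 - ((c 0).2 : ℤ)) + lam ^ (-((c 0).2 : ℤ)) * T)) =
        (density lam n ((c 0).1 / ((c 0).2 + x 1)) -
        (c 0).1 * (C * lam ^ (1 - ((c 0).2 : ℤ)) - lam ^ (-((c 0).2 : ℤ)) * D)) +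
        -((c 0).1 * (lam ^ (-((c 0).2 : ℤ)) * (D + C * T))) := by ring
    rw [e]
    refine (abs_add_le _ _).trans ?_
    rw [abs_neg, abs_mul, hsabs, one_mul, abs_mul, abs_of_pos hlp0]
    have : lam ^ (-((c 0).2 : ℤ)) * |D + C * T| ≤ 5 / 9 * (K * (3 / 4) ^ k) :=
      mul_le_mul hlp hn2 (abs_nonneg _) (by norm_num)
    rw [pow_succ]
    linarith

theorem length_initial (c : ℕ → ℤ × ℕ) (k : ℕ) : (initial c k).length = k := by
  simp [initial]

theorem termSum_initial (lam : ℝ) (c : ℕ → ℤ × ℕ) (k : ℕ) :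
    termSum lam (initial c k) = ∑ i ∈ Finset.range k, term lam (initial c (i + 1)) := by
  rw [termSum_eq_range, length_initial]
  refine Finset.sum_congr rfl fun i hi => ?_
  congr 1
  rw [Finset.mem_range] at hi
  rw [initial, initial, ← List.map_take, List.take_range, min_eq_left (by omega)]

theorem abs_term_initial_le (hlam : 1 < lam) (k : ℕ) : ∀ (c : ℕ → ℤ × ℕ), (∀ j, Odd (c j).2) →
    (∀ j, (c j).1 = 1 ∨ (c j).1 = -1) → |term lam (initial c k)| ≤ lam * lam⁻¹ ^ k := by
  have hl0 : 0 < lam := by linarith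
  induction k with
  | zero => intro c _ _; simp [initial, term_nil, abs_of_pos hl0]
  | succ k ih =>
    intro c ho hs
    rw [initial_succ, term_cons hl0, abs_mul, abs_mul, abs_neg]
    have h1 : |((c 0).1 : ℝ)| = 1 := by rcases hs 0 with h | h <;> rw [h] <;> simp
    have h2 : lam ^ (-((c 0).2 : ℤ)) ≤ lam⁻¹ := by
      rw [← zpow_neg_one]
      refine zpow_le_zpow_right₀ hlam.le ?_
      have := (ho 0).pos
      omega
    rw [h1, one_mul, abs_of_pos (by positivity), pow_succ, ← mul_assoc, mul_comm _ lam⁻¹]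
    exact mul_le_mul h2 (ih _ (fun j => ho _) fun j => hs _) (abs_nonneg _) (by positivity)

/-- Interchange of limits: first k is chosen to make both the remainder of the series and K(3/4)^k
small, then n is taken large. -/
theorem tendsto_density_orbit (hlam : 9 / 5 < lam)
    (hC : Tendsto (fun n : ℤ => total n / lam ^ n) atTop (𝓝 C))
    {c : ℕ → ℤ × ℕ} {x : ℕ → ℝ} (h : IsOrbit c x) :
    ∃ S : ℝ, HasSum (fun i : ℕ => term lam (initial c (i + 1))) S ∧
      Tendsto (fun n : ℤ => density lam n (x 0)) atTop (𝓝 (-(C * S))) := by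
  have hl0 : 0 < lam := by linarith
  have hsum : Summable (fun i : ℕ => term lam (initial c (i + 1))) := by
    have hg : Summable (fun i : ℕ => lam * lam⁻¹ ^ (i + 1)) :=
      ((summable_nat_add_iff 1).2 (summable_geometric_of_lt_one (by positivity)
        (inv_lt_one_of_one_lt₀ (by linarith)))).mul_left lam
    exact Summable.of_norm_bounded hg fun i => by
      rw [Real.norm_eq_abs]
      exact abs_term_initial_le (by linarith) _ c h.odd h.sign
  refine ⟨_, hsum.hasSum, ?_⟩
  set S := ∑' i : ℕ, term lam (initial c (i + 1))
  obtain ⟨K, hK⟩ := eventually_density_orbit hlam hC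
  have hT : Tendsto (fun k => K * (3 / 4 : ℝ) ^ k +
      |C * termSum lam (initial c k) - C * S|) atTop (𝓝 0) := by
    have h1 : Tendsto (fun k => termSum lam (initial c k)) atTop (𝓝 S) := by
      simp only [termSum_initial]
      exact hsum.hasSum.tendsto_sum_nat
    have h2 := ((h1.const_mul C).sub_const (C * S)).abs
    have h3 := (tendsto_pow_atTop_nhds_zero_of_lt_one (r := (3 / 4 : ℝ)) (by norm_num)
      (by norm_num)).const_mul K
    simpa using h3.add h2
  rw [Metric.tendsto_nhds]
  intro δ hδ
  obtain ⟨k, hk⟩ := (hT.eventually (gt_mem_nhds hδ)).exists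
  refine (hK k c x h).mono fun n hn => ?_
  rw [Real.dist_eq]
  have e : density lam n (x 0) - -(C * S) = (density lam n (x 0) + C * termSum lam (initial c k)) -
    (C * termSum lam (initial c k) - C * S) := by ring
  rw [e]
  refine lt_of_le_of_lt (abs_sub _ _) ?_
  linarith

end

/-! ### Existence of expansions; rational numbers -/

/-- Every `y ≥ 1` is within distance one of an odd positive integer. -/
theorem exists_odd_near {K : Type*} [Field K] [LinearOrder K] [IsStrictOrderedRing K] [FloorRing K]
    {y : K} (hy : 1 ≤ y) : ∃ a : ℕ, Odd a ∧ -1 < y - a ∧ y - a ≤ 1 := by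
  have h1 := Int.le_ceil (y / 2)
  have h2 := Int.ceil_lt_add_one (y / 2)
  have hpos : 0 < ⌈y / 2⌉ := Int.ceil_pos.2 (by positivity)
  obtain ⟨k, hk⟩ : ∃ k : ℕ, ⌈y / 2⌉ = k + 1 := ⟨(⌈y / 2⌉ - 1).toNat, by omega⟩
  rw [hk] at h1 h2
  push_cast at h1 h2
  refine ⟨2 * k + 1, ⟨k, rfl⟩, ?_, ?_⟩ <;> push_cast <;> linarith

/-- Every rational number in `(-1, 1]` has a finite expansion. -/
theorem exists_isTail (q : ℕ) : ∀ p : ℤ, 0 < q → -(q : ℤ) < p → p ≤ q →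
    ∃ c : Digits, IsTail c ∧ value c = (p : ℚ) / q := by
  induction q using Nat.strong_induction_on with
  | _ q ih =>
  intro p hq h1 h2
  rcases eq_or_lt_of_le h2 with rfl | h2
  · have : (q : ℚ) ≠ 0 := by positivity
    exact ⟨[(1, 1)], by simp [IsTail], by simp [value, this]⟩
  by_cases hp : p = 0
  · exact ⟨[], by simp [IsTail], by simp [value, hp]⟩
  obtain ⟨ε, r, hε, hpr, hr⟩ : ∃ (ε : ℤ) (r : ℕ), (ε = 1 ∨ ε = -1) ∧ p = ε * r ∧ 0 < r := by
    rcases lt_or_gt_of_ne hp with h | h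
    · exact ⟨-1, p.natAbs, by simp, by omega, by omega⟩
    · exact ⟨1, p.natAbs, by simp, by omega, by omega⟩
  have hrq : r < q := by
    rcases hε with rfl | rfl <;> omega
  have hrQ : (0 : ℚ) < r := by exact_mod_cast hr
  have hqQ : (0 : ℚ) < q := by exact_mod_cast hq
  have hy : (1 : ℚ) < q / r := by
    rw [one_lt_div hrQ]; exact_mod_cast hrq
  -- Euclidean algorithm with odd quotients: the remainder over r lies in (-1, 1], the range of tail
  -- values, and r < q.
  obtain ⟨a, ha, ha1, ha2⟩ := exists_odd_near hy.le
  have e : (q : ℚ) / r - a = ((q - a * r : ℤ) : ℚ) / r := by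
    push_cast; field_simp
  rw [e] at ha1 ha2
  obtain ⟨t, ht, hv⟩ := ih r hrq (q - a * r) hr
    (by rw [lt_div_iff₀ hrQ] at ha1; exact_mod_cast (by linarith : (-(r : ℚ)) < ((q - a * r : ℤ) : ℚ)))
    (by rw [div_le_iff₀ hrQ] at ha2; exact_mod_cast (by linarith : ((q - a * r : ℤ) : ℚ) ≤ (r : ℚ)))
  rw [← e] at hv
  refine ⟨(ε, a) :: t, ⟨ha, hε, ?_, ?_, ht⟩, ?_⟩
  · rintro rfl ha'
    simp only at ha'
    subst ha'
    simp [value] at hv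
    linarith
  · intro f hf
    have hsf := ht.bounds.2.2 f hf
    have hsign : f.1 = 1 ∨ f.1 = -1 := by
      cases t with
      | nil => simp at hf
      | cons g u => simp at hf; rw [← hf]; exact ht.2.1
    simp only
    rcases hsign with h | h
    · have := ha.pos
      omega
    · by_cases ha' : a = 1
      · subst ha'
        rw [h, hv] at hsf
        push_cast at hsf
        linarith
      · have := three_le_of_odd ha ha'
        omega
  · rw [value_cons, hv, hpr, add_sub_cancel]
    push_cast
    rw [div_div_eq_mul_div]

theorem exists_finiteRep {x : ℝ} (hx : x ∈ Set.Icc (0 : ℝ) 1)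
    (hr : x ∈ Set.range ((↑) : ℚ → ℝ)) : ∃ c : Digits, FiniteRep x c := by
  obtain ⟨r, rfl⟩ := hr
  have h0 : 0 ≤ r := by exact_mod_cast hx.1
  have h1 : r ≤ 1 := by exact_mod_cast hx.2
  have hden : (0 : ℚ) < r.den := by exact_mod_cast r.pos
  have hnum : (r.num : ℚ) = r * r.den := (Rat.mul_den_eq_num r).symm
  obtain ⟨c, hc, hv⟩ := exists_isTail r.den r.num r.pos
    (by have := Rat.num_nonneg.2 h0; have := r.pos; omega)
    (by
      have : (r.num : ℚ) ≤ r.den := by rw [hnum]; nlinarith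
      exact_mod_cast this)
  rw [Rat.num_div_den] at hv
  refine ⟨c, (isFinite_iff c).2 ⟨hc, fun d hd => ?_⟩, by rw [hv]⟩
  have h2 := hc.bounds.2.2 d hd
  have hs : d.1 = 1 ∨ d.1 = -1 := by
    cases c with
    | nil => simp at hd
    | cons g u => simp at hd; rw [← hd]; exact hc.2.1
  rcases hs with h | h
  · exact h
  · rw [h, hv] at h2
    push_cast at h2
    linarith

/-- A rational number does not start an orbit. -/
theorem not_isOrbit_rat (q : ℕ) : ∀ (p : ℤ) (c : ℕ → ℤ × ℕ) (x : ℕ → ℝ), 0 < q →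
    x 0 = (p : ℝ) / q → ¬ IsOrbit c x := by
  induction q using Nat.strong_induction_on with
  | _ q ih =>
  intro p c x hq hx h
  have hqR : (0 : ℝ) < q := by exact_mod_cast hq
  have hpos := h.pos 0
  have heq := h.eq 0
  have hlt := h.abs_lt 0
  rw [hx, abs_div, abs_of_pos hqR, div_lt_one hqR] at hlt
  have hlt' : p.natAbs < q := by
    have : ((|p| : ℤ) : ℝ) < q := by push_cast; exact hlt
    have : |p| < (q : ℤ) := by exact_mod_cast this
    rw [Int.abs_eq_natAbs] at this
    exact_mod_cast this
  have hsR : ((c 0).1 : ℝ) ≠ 0 := by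
    rcases h.sign 0 with h | h <;> rw [h] <;> simp
  have hp0 : (p : ℝ) ≠ 0 := by
    intro hp
    rw [hx, hp, zero_div] at heq
    exact (div_ne_zero hsR hpos.ne') heq.symm
  have hp0' : p ≠ 0 := by exact_mod_cast hp0
  -- Inverting the orbit equation gives the next tail the denominator |p| < q, whence infinite
  -- descent.
  have hx1 : x 1 = (c 0).1 * q / p - (c 0).2 := by
    rw [hx] at heq
    simp only [zero_add] at heq hpos
    rw [div_eq_div_iff hqR.ne' hpos.ne'] at heq
    rw [eq_sub_iff_add_eq, eq_div_iff hp0]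
    linarith
  obtain ⟨ε, r, hr, hpε, hε⟩ : ∃ (ε : ℤ) (r : ℕ), p.natAbs = r ∧ p = ε * r ∧ ε * ε = 1 := by
    rcases le_total 0 p with h | h
    · exact ⟨1, p.natAbs, rfl, by omega, by norm_num⟩
    · exact ⟨-1, p.natAbs, rfl, by omega, by norm_num⟩
  have hnR : (r : ℝ) ≠ 0 := by
    exact_mod_cast hr ▸ Int.natAbs_ne_zero.2 hp0'
  refine ih r (hr ▸ hlt') (ε * (c 0).1 * q - (c 0).2 * r) _ _ (by omega) ?_ h.shift
  have hpR : (p : ℝ) = ε * r := by exact_mod_cast hpε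
  have hεR : (ε : ℝ) * ε = 1 := by exact_mod_cast hε
  have hε0 : (ε : ℝ) ≠ 0 := fun h0 => by rw [h0] at hεR; simp at hεR
  simp only [zero_add]
  rw [hx1, hpR]
  push_cast
  field_simp
  linear_combination (-(c 0).1 * (q : ℝ)) * hεR

theorem exists_step {x : ℝ} (hx : Irrational x) (h1 : |x| < 1) :
    ∃ d : ℤ × ℕ, Odd d.2 ∧ (d.1 = 1 ∨ d.1 = -1) ∧ ∃ τ : ℝ, Irrational τ ∧ |τ| < 1 ∧
      x = d.1 / (d.2 + τ) := by
  have hx0 : x ≠ 0 := hx.ne_zero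
  have hax : 0 < |x| := abs_pos.2 hx0
  obtain ⟨a, ha, ha1, ha2⟩ := exists_odd_near (y := 1 / |x|) ((one_le_div hax).2 h1.le)
  have hirr : Irrational (1 / |x| - a) := by
    have : Irrational |x| := by
      rcases abs_choice x with h | h <;> rw [h]
      · exact hx
      · exact hx.neg
    rw [one_div]
    exact this.inv.sub_natCast a
  obtain ⟨ε, hε, hεx⟩ : ∃ ε : ℤ, (ε = 1 ∨ ε = -1) ∧ x = ε * |x| := by
    rcases abs_choice x with h | h
    · exact ⟨1, by simp, by rw [h]; simp⟩
    · exact ⟨-1, by simp, by rw [h]; simp⟩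
  refine ⟨(ε, a), ha, hε, 1 / |x| - a, hirr, ?_, ?_⟩
  · rw [abs_lt]
    refine ⟨ha1, lt_of_le_of_ne ha2 ?_⟩
    exact_mod_cast hirr.ne_one
  · simp only
    rw [add_sub_cancel, div_div_eq_mul_div, div_one]
    exact hεx

theorem exists_orbit {x : ℝ} (hx : Irrational x) (h1 : |x| < 1) :
    ∃ (c : ℕ → ℤ × ℕ) (X : ℕ → ℝ), X 0 = x ∧ IsOrbit c X := by
  choose d hd hs τ hτ hτ1 heq using fun y : {y : ℝ // Irrational y ∧ |y| < 1} =>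
    exists_step y.2.1 y.2.2
  let f : {y : ℝ // Irrational y ∧ |y| < 1} → {y : ℝ // Irrational y ∧ |y| < 1} :=
    fun y => ⟨τ y, hτ y, hτ1 y⟩
  let z : ℕ → {y : ℝ // Irrational y ∧ |y| < 1} := fun n => f^[n] ⟨x, hx, h1⟩
  refine ⟨fun n => d (z n), fun n => (z n).1, rfl, fun n => hd _, fun n => hs _,
    fun n => (z n).2.2, fun n => ?_⟩
  have : z (n + 1) = f (z n) := Function.iterate_succ_apply' _ _ _
  rw [this]
  exact heq (z n)

/-! ### Convergent infinite strings yield orbits -/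

/-- Truncations of infinite tails. -/
theorem value_initial_bounds (k : ℕ) : ∀ c : ℕ → ℤ × ℕ, (∀ j, Odd (c j).2) →
    (∀ j, (c j).1 = 1 ∨ (c j).1 = -1) → (∀ j, 2 ≤ ((c j).2 : ℤ) + (c (j + 1)).1) →
    |value (initial c k)| ≤ 1 ∧ 0 ≤ (c 0).1 * value (initial c k) ∧
      1 ≤ ((c 0).2 : ℚ) + value (initial (fun j => c (j + 1)) k) := by
  induction k with
  | zero =>
    intro c ho _ _
    have : (1 : ℚ) ≤ (c 0).2 := by exact_mod_cast (ho 0).pos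
    simpa [initial, value] using this
  | succ k ih =>
    -- A truncation may end in -1/1, against the last-pair condition, so only non-strict bounds are
    -- available.
    have key : ∀ c : ℕ → ℤ × ℕ, (∀ j, Odd (c j).2) →
        (∀ j, (c j).1 = 1 ∨ (c j).1 = -1) → (∀ j, 2 ≤ ((c j).2 : ℤ) + (c (j + 1)).1) →
        |value (initial c (k + 1))| ≤ 1 ∧ 0 ≤ (c 0).1 * value (initial c (k + 1)) := by
      intro c ho hs hc
      have h1 := (ih c ho hs hc).2.2
      have hle : 1 / (((c 0).2 : ℚ) + value (initial (fun j => c (j + 1)) k)) ≤ 1 := by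
        rw [div_le_one (by linarith)]; exact h1
      have hip : 0 < 1 / (((c 0).2 : ℚ) + value (initial (fun j => c (j + 1)) k)) := by positivity
      rw [initial_succ, value_cons]
      rcases hs 0 with h | h
      · rw [h]
        push_cast
        rw [abs_of_pos hip, one_mul]
        exact ⟨hle, hip.le⟩
      · rw [h]
        push_cast
        rw [neg_div, abs_neg, abs_of_pos hip, neg_one_mul, neg_neg]
        exact ⟨hle, hip.le⟩
    intro c ho hs hc
    obtain ⟨h1, h2⟩ := key c ho hs hc
    refine ⟨h1, h2, ?_⟩
    obtain ⟨h3, h4⟩ := key (fun j => c (j + 1)) (fun _ => ho _) (fun _ => hs _) fun _ => hc _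
    have h5 := hc 0
    simp only [zero_add] at h4 h5
    by_cases ha : (c 0).2 = 1
    · have h6 : (c 1).1 = 1 := by
        rcases hs 1 with h | h <;> omega
      rw [h6] at h4
      rw [ha]
      push_cast at h4 ⊢
      linarith
    · have : (3 : ℚ) ≤ (c 0).2 := by exact_mod_cast three_le_of_odd (ho 0) ha
      linarith [(abs_le.1 h3).1]

/-- If the truncations converge, then so do the truncations of the next tail. -/
theorem tendsto_tail {c : ℕ → ℤ × ℕ} (ho : ∀ j, Odd (c j).2)
    (hs : ∀ j, (c j).1 = 1 ∨ (c j).1 = -1) (hc : ∀ j, 2 ≤ ((c j).2 : ℤ) + (c (j + 1)).1) {x : ℝ}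
    (hx : Tendsto (fun k => (value (initial c k) : ℝ)) atTop (𝓝 x)) :
    Tendsto (fun k => (value (initial (fun j => c (j + 1)) k) : ℝ)) atTop
      (𝓝 ((c 0).1 / x - (c 0).2)) ∧ x ≠ 0 := by
  have hx' := (tendsto_add_atTop_iff_nat 1).2 hx
  have hge : ∀ k, (1 : ℝ) ≤ ((c 0).2 : ℝ) + value (initial (fun j => c (j + 1)) k) := fun k => by
    exact_mod_cast (value_initial_bounds k c ho hs hc).2.2
  have hle : ∀ k, (value (initial (fun j => c (j + 1)) k) : ℝ) ≤ 1 := fun k => by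
    exact_mod_cast (abs_le.1 (value_initial_bounds k (fun j => c (j + 1)) (fun _ => ho _)
      (fun _ => hs _) fun _ => hc _).1).2
  have hsabs : |((c 0).1 : ℝ)| = 1 := by
    rcases hs 0 with h | h <;> rw [h] <;> simp
  have hs0 : ((c 0).1 : ℝ) ≠ 0 := fun h => by rw [h] at hsabs; simp at hsabs
  have hval : ∀ k, (value (initial c (k + 1)) : ℝ) =
      (c 0).1 / (((c 0).2 : ℝ) + value (initial (fun j => c (j + 1)) k)) := fun k => by
    rw [initial_succ, value_cons]; push_cast; rfl
  -- All nonempty truncations have absolute value at least 1/(a_1+1), so the limit is nonzero and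
  -- the first digit can be peeled off.
  have hx0 : x ≠ 0 := by
    have hlow : 1 / (((c 0).2 : ℝ) + 1) ≤ |x| := by
      refine ge_of_tendsto' hx'.abs fun k => ?_
      have := hge k
      rw [hval, abs_div, hsabs, abs_of_pos (by linarith)]
      exact one_div_le_one_div_of_le (by linarith) (by linarith [hle k])
    intro h
    rw [h, abs_zero] at hlow
    have : (0 : ℝ) < 1 / (((c 0).2 : ℝ) + 1) := by positivity
    linarith
  refine ⟨?_, hx0⟩
  refine ((tendsto_const_nhds (x := ((c 0).1 : ℝ))).div hx' hx0 |>.sub_const ((c 0).2 : ℝ)).congr fun k => ?_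
  simp only [Pi.div_apply]
  rw [hval, div_div_cancel₀ hs0, add_sub_cancel_left]

/-- Convergence passes from each tail to the next. The non-strict bounds become strict in the limit
because no tail is 0: after a quotient 1 the next sign is +, so that tail is strictly positive. -/
theorem InfiniteRep.exists_orbit {x : ℝ} {c : ℕ → ℤ × ℕ} (h : InfiniteRep x c) :
    ∃ X : ℕ → ℝ, X 0 = x ∧ IsOrbit c X := by
  obtain ⟨⟨ho, hs, -, hc⟩, hx⟩ := h
  let X : ℕ → ℝ := fun n => Nat.rec x (fun j y => (c j).1 / y - (c j).2) n
  have hX : ∀ j, Tendsto (fun k => (value (initial (fun i => c (i + j)) k) : ℝ)) atTop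
      (𝓝 (X j)) := by
    intro j
    induction j with
    | zero => exact hx
    | succ j ih =>
      have := (tendsto_tail (fun _ => ho _) (fun _ => hs _)
        (fun i => by have := hc (i + j); rwa [show i + j + 1 = i + 1 + j by ring] at this) ih).1
      simp only [zero_add] at this
      refine this.congr fun k => ?_
      congr 4
      funext i
      congr 1
      ring
  have hX0 : ∀ j, X j ≠ 0 := fun j =>
    (tendsto_tail (fun _ => ho _) (fun _ => hs _)
      (fun i => by have := hc (i + j); rwa [show i + j + 1 = i + 1 + j by ring] at this) (hX j)).2
  have hsucc : ∀ j, X (j + 1) = (c j).1 / X j - (c j).2 := fun j => rfl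
  have hs0 : ∀ j, ((c j).1 : ℝ) ≠ 0 := fun j => by
    rcases hs j with h | h <;> rw [h] <;> simp
  have hsum : ∀ j, ((c j).2 : ℝ) + X (j + 1) = (c j).1 / X j := fun j => by rw [hsucc]; ring
  have heq : ∀ j, X j = (c j).1 / ((c j).2 + X (j + 1)) := fun j => by
    rw [hsum, div_div_cancel₀ (hs0 j)]
  have hbd : ∀ j, |X j| ≤ 1 ∧ 0 ≤ (c j).1 * X j := by
    intro j
    have hb := fun k => value_initial_bounds k (fun i => c (i + j)) (fun _ => ho _) (fun _ => hs _)
      (fun i => by have := hc (i + j); rwa [show i + j + 1 = i + 1 + j by ring] at this)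
    constructor
    · exact le_of_tendsto' (hX j).abs fun k => by exact_mod_cast (hb k).1
    · refine ge_of_tendsto' ((hX j).const_mul ((c j).1 : ℝ)) fun k => ?_
      have := (hb k).2.1
      simp only [zero_add] at this
      exact_mod_cast this
  refine ⟨X, rfl, ho, hs, fun j => ?_, heq⟩
  have hone : 1 < ((c j).2 : ℝ) + X (j + 1) := by
    by_cases ha : (c j).2 = 1
    · have h6 : (c (j + 1)).1 = 1 := by
        have := hc j
        rcases hs (j + 1) with h | h <;> omega
      have := (hbd (j + 1)).2
      rw [h6, Int.cast_one, one_mul] at this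
      have := lt_of_le_of_ne this (hX0 (j + 1)).symm
      rw [ha]
      push_cast
      linarith
    · have : (3 : ℝ) ≤ (c j).2 := by exact_mod_cast three_le_of_odd (ho j) ha
      linarith [(abs_le.1 (hbd (j + 1)).1).1]
  have hp := one_pos.trans hone
  rw [heq j, abs_div, abs_of_pos hp, div_lt_one hp]
  rcases hs j with h | h <;> rw [h] <;> simpa using hone

/-! ### From counts to the distribution function -/

theorem distribution_Y (n : ℕ) {x : ℝ} (hx : 0 ≤ x) :
    distribution (Y n) x = (1 + count (n + 1) x) / (1 + total (n + 1)) := by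
  have h0 : (0 : ℝ) ∉ Pos (n + 1) := fun h => lt_irrefl _ (pos_of_mem_Pos h)
  have hY : Y n = insert 0 (Pos (n + 1)) := by
    ext y; rw [mem_Y_iff]; rfl
  have hYx : {ξ ∈ Y n | ξ ≤ x} = insert 0 (Pos (n + 1) ∩ Set.Iic x) := by
    ext y
    rw [hY]
    constructor
    · rintro ⟨rfl | h, h'⟩
      · exact Or.inl rfl
      · exact Or.inr ⟨h, h'⟩
    · rintro (rfl | ⟨h, h'⟩)
      · exact ⟨Or.inl rfl, hx⟩
      · exact ⟨Or.inr h, h'⟩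
  rw [distribution, hYx, hY, Set.ncard_insert_of_notMem h0 (finite_Pos _),
    Set.ncard_insert_of_notMem (fun h => h0 h.1) ((finite_Pos _).inter_of_left _), count, total]
  push_cast
  rw [add_comm 1, add_comm 1]

/-- The added ones in `distribution_Y` count the point 0 and are negligible against lam^(n+1); the
constant C cancels. -/
theorem tendsto_distribution {lam C S : ℝ} (hlam : 1 < lam) (hC0 : 0 < C)
    (hC : Tendsto (fun n : ℤ => total n / lam ^ n) atTop (𝓝 C)) {x : ℝ} (hx : 0 ≤ x)
    (h : Tendsto (fun n : ℤ => density lam n x) atTop (𝓝 (-(C * S)))) :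
    Tendsto (fun n => distribution (Y n) x) atTop (𝓝 (-S)) := by
  have hl0 : 0 < lam := by linarith
  have hcast : Tendsto (fun n : ℕ => (n : ℤ) + 1) atTop atTop :=
    tendsto_atTop_add_const_right _ 1 tendsto_natCast_atTop_atTop
  have hpow : Tendsto (fun n : ℕ => (lam⁻¹) ^ (n + 1)) atTop (𝓝 0) :=
    (tendsto_add_atTop_iff_nat 1).2 (tendsto_pow_atTop_nhds_zero_of_lt_one (by positivity)
      (inv_lt_one_of_one_lt₀ hlam))
  have hlim := (hpow.add (h.comp hcast)).div (hpow.add (hC.comp hcast)) (by simpa using hC0.ne')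
  rw [zero_add, zero_add, neg_div, mul_div_cancel_left₀ S hC0.ne'] at hlim
  refine hlim.congr fun n => ?_
  have hp : 0 < lam ^ ((n : ℤ) + 1) := by positivity
  have e : lam⁻¹ ^ (n + 1) = 1 / lam ^ ((n : ℤ) + 1) := by
    rw [inv_pow, one_div]; norm_cast
  rw [distribution_Y n hx]
  simp only [Pi.div_apply, Function.comp, density]
  rw [signedCount_of_nonneg _ hx, e, ← add_div, ← add_div, div_div_div_cancel_right₀ hp.ne']

end OddCF

theorem theorem2 :
    ∃ lam : ℝ,
      (∀ t : ℝ, t ^ 3 - t ^ 2 - t - 1 = 0 ↔ t = lam) ∧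
      ∃ F₀ : ℝ → ℝ,
        OddCF.IsLimitDistribution OddCF.Y F₀ ∧
        ∀ x ∈ Set.Icc (0 : ℝ) 1,
          (∀ c : OddCF.Digits, OddCF.FiniteRep x c →
            F₀ x = -∑ i ∈ Finset.Icc 1 c.length, OddCF.term lam (c.take i)) ∧
          (∀ c : ℕ → ℤ × ℕ, OddCF.InfiniteRep x c →
            HasSum (fun i : ℕ => OddCF.term lam (OddCF.initial c (i + 1))) (-F₀ x)) ∧
          (x ∈ Set.range ((↑) : ℚ → ℝ) →
            (∃ c : OddCF.Digits, OddCF.FiniteRep x c) ∧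
              ¬ ∃ c : ℕ → ℤ × ℕ, OddCF.InfiniteRep x c) := by
  obtain ⟨lam, h1, h2, h3, hroot⟩ := OddCF.exists_tribonacci_root
  obtain ⟨C, hC0, hC⟩ := OddCF.total_asymptotic h1 h2 h3
  have hl1 : 1 < lam := by linarith
  have hfin : ∀ x ∈ Set.Icc (0 : ℝ) 1, ∀ c : OddCF.Digits, OddCF.FiniteRep x c →
      Filter.Tendsto (fun n => OddCF.distribution (OddCF.Y n) x) Filter.atTop
        (nhds (-∑ i ∈ Finset.Icc 1 c.length, OddCF.term lam (c.take i))) := by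
    rintro x hx c ⟨hc, rfl⟩
    exact OddCF.tendsto_distribution hl1 hC0 hC hx.1
      (OddCF.tendsto_density_value hl1 hC c ((OddCF.isFinite_iff c).1 hc).1)
  have hinf : ∀ x ∈ Set.Icc (0 : ℝ) 1, ∀ (c : ℕ → ℤ × ℕ) (X : ℕ → ℝ), X 0 = x →
      OddCF.IsOrbit c X → ∃ S : ℝ,
        HasSum (fun i : ℕ => OddCF.term lam (OddCF.initial c (i + 1))) S ∧
        Filter.Tendsto (fun n => OddCF.distribution (OddCF.Y n) x) Filter.atTop (nhds (-S)) := by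
    rintro x hx c X rfl hX
    obtain ⟨S, hS, hlim⟩ := OddCF.tendsto_density_orbit h1 hC hX
    exact ⟨S, hS, OddCF.tendsto_distribution hl1 hC0 hC hx.1 hlim⟩
  have hex : ∀ x ∈ Set.Icc (0 : ℝ) 1, ∃ L : ℝ,
      Filter.Tendsto (fun n => OddCF.distribution (OddCF.Y n) x) Filter.atTop (nhds L) := by
    intro x hx
    by_cases hr : x ∈ Set.range ((↑) : ℚ → ℝ)
    · obtain ⟨c, hc⟩ := OddCF.exists_finiteRep hx hr
      exact ⟨_, hfin x hx c hc⟩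
    · have hx1 : |x| < 1 := by
        rw [abs_of_nonneg hx.1]
        refine lt_of_le_of_ne hx.2 ?_
        rintro rfl
        exact hr ⟨1, by simp⟩
      -- An orbit suffices for existence of the limit; its digits need not be shown to form an
      -- `InfiniteRep`.
      obtain ⟨c, X, hX0, hX⟩ := OddCF.exists_orbit hr hx1
      obtain ⟨S, -, hS⟩ := hinf x hx c X hX0 hX
      exact ⟨_, hS⟩
  choose! F hF using hex
  refine ⟨lam, hroot, F, ⟨fun n => ?_, hF⟩, fun x hx => ⟨fun c hc => ?_, fun c hc => ?_, fun hr =>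
    ⟨OddCF.exists_finiteRep hx hr, ?_⟩⟩⟩
  · have hY : OddCF.Y n = insert 0 (OddCF.Pos (n + 1)) := by
      ext y; rw [OddCF.mem_Y_iff]; rfl
    exact ⟨hY ▸ (OddCF.finite_Pos _).insert _, hY ▸ Set.insert_nonempty _ _, fun y hy => hy.1.2⟩
  · exact tendsto_nhds_unique (hF x hx) (hfin x hx c hc)
  · obtain ⟨X, hX0, hX⟩ := hc.exists_orbit
    obtain ⟨S, hS, hlim⟩ := hinf x hx c X hX0 hX
    rw [tendsto_nhds_unique (hF x hx) hlim, neg_neg]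
    exact hS
  · rintro ⟨c, hc⟩
    obtain ⟨X, hX0, hX⟩ := hc.exists_orbit
    obtain ⟨r, hr⟩ := hr
    refine OddCF.not_isOrbit_rat r.den r.num c X r.pos ?_ hX
    rw [hX0, ← hr, Rat.cast_def]
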